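/- Codes are subspaces of $\mathbb{F}_3^n$; an $[n,k,d]$ code has length $n$, dimension $k$ and minimum non-zero Hamming weight $d$, and $A_i$ denotes its number of codewords of weight $i$. A code $C$ of length $n$ is self-dual if $C=C^\perp$ for the standard inner product. A square matrix over $\mathbb{F}_3$ is circulant (resp. negacirculant) if each row after the first is the cyclic shift of the preceding row one place to the right, where the entry that wraps around is multiplied by $1$ (resp. by $-1$). A code of length $2m$ is double circulant if it has a generator matrix $(I_m \mid R)$ with $R$ an $m\times m$ circulant matrix (pure), or a generator matrix $(I_m \mid B)$ where $$B=\begin{pmatrix}\alpha&\beta&\cdots&\beta\\ \gamma&&&\\ \vdots&&R'&\\ \gamma&&&\end{pmatrix}$$ with $R'$ an $(m-1)\times(m-1)$ circulant matrix and $\alpha,\beta,\gamma\in\mathbb{F}_3$ (bordered). It is double twistulant if it has a generator matrix $(I_m \mid N)$ with $N$ an $m\times m$ negacirculant matrix. A code $C$ performs better than a code $C'$ of the same length $n$ if the weight distribution $(A_0,\dots,A_n)$ of $C$ is lexicographically smaller than the weight distribution $(A'_0,\dots,A'_n)$ of $C'$, that is, there is $s\in\{0,\dots,n\}$ with $A_i=A'_i$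 for all $i<s$ and $A_s<A'_s$. Theorem. Let $(n,d)\in\{(8,3),(16,6),(20,6),(28,9),(32,9),(44,12)\}$. Then there is a double circulant $[n,n/2,d]$ code which is not self-dual and which performs better than every self-dual $[n,n/2,d]$ code. There is also a double twistulant $[n,n/2,d]$ code which is not self-dual and which performs better than every self-dual $[n,n/2,d]$ code. -/

import Mathlib

/-- A ternary code of length `n`: a subspace of `𝔽₃ⁿ`. -/
abbrev TernaryCode (n : ℕ) : Type := Submodule (ZMod 3) (Fin n → ZMod 3)

namespace TernaryCode

/-- `C` has minimum weight `d`: `d` is the least Hamming weight of a non-zero codeword. -/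
def HasMinWeight {n : ℕ} (C : TernaryCode n) (d : ℕ) : Prop :=
  IsLeast {w : ℕ | ∃ c ∈ C, c ≠ 0 ∧ hammingNorm c = w} d

/-- `C`, of length `n`, is an `[n, k, d]` code. -/
def HasParams {n : ℕ} (C : TernaryCode n) (k d : ℕ) : Prop :=
  Module.finrank (ZMod 3) C = k ∧ C.HasMinWeight d

/-- The number `A_i` of codewords of weight `i`. -/
noncomputable def weightCount {n : ℕ} (C : TernaryCode n) (i : ℕ) : ℕ :=
  Set.ncard {c : Fin n → ZMod 3 | c ∈ C ∧ hammingNorm c = i}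

/-- The dual code with respect to the standard inner product. -/
def dual {n : ℕ} (C : TernaryCode n) : TernaryCode n where
  carrier := {x | ∀ c ∈ C, x ⬝ᵥ c = 0}
  zero_mem' := fun c _ => zero_dotProduct c
  add_mem' := fun {x y} hx hy c hc => by
    rw [add_dotProduct, hx c hc, hy c hc, add_zero]
  smul_mem' := fun a x hx c hc => by
    rw [smul_dotProduct, hx c hc, smul_zero]

/-- `C` is self-dual. -/
def IsSelfDual {n : ℕ} (C : TernaryCode n) : Prop := C = C.dual

/-- `C` performs better than `C'`: the weight distribution `(A_0, …, A_n)` of `C` is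
lexicographically smaller than that of `C'`. -/
def PerformsBetter {n : ℕ} (C C' : TernaryCode n) : Prop :=
  ∃ s : ℕ, s ≤ n ∧ (∀ i < s, C.weightCount i = C'.weightCount i) ∧
    C.weightCount s < C'.weightCount s

/-- The `m × m` matrix with first row `r = (r_0, …, r_{m-1})` in which every row is the cyclic
shift to the right of the preceding one, the entry that wraps around being multiplied by `c`.
(Subtraction in `Fin m` is modulo `m`.) -/
def twistMatrix {m : ℕ} (c : ZMod 3) (r : Fin m → ZMod 3) : Matrix (Fin m) (Fin m) (ZMod 3) :=
  Matrix.of fun i j => if i ≤ j then r (j - i) else c * r (j - i)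

/-- Circulant matrices. -/
def IsCirculant {m : ℕ} (R : Matrix (Fin m) (Fin m) (ZMod 3)) : Prop :=
  ∃ r : Fin m → ZMod 3, R = twistMatrix 1 r

/-- Negacirculant matrices. -/
def IsNegacirculant {m : ℕ} (R : Matrix (Fin m) (Fin m) (ZMod 3)) : Prop :=
  ∃ r : Fin m → ZMod 3, R = twistMatrix (-1) r

/-- The `(k+1) × (k+1)` matrix with first row `(α, β, …, β)`, first column `(α, γ, …, γ)ᵀ` and
lower right `k × k` block `R`. -/
def borderedMatrix {k : ℕ} (α β γ : ZMod 3) (R : Matrix (Fin k) (Fin k) (ZMod 3)) :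
    Matrix (Fin (k + 1)) (Fin (k + 1)) (ZMod 3) :=
  Matrix.of (Fin.cons (Fin.cons α fun _ => β) fun i => Fin.cons γ (R i))

/-- `C`, of length `n = 2m`, is the row space of the `m × n` generator matrix `(I_m  M)`. -/
def IsGeneratedBy {n m : ℕ} (C : TernaryCode n) (h : n = m + m)
    (M : Matrix (Fin m) (Fin m) (ZMod 3)) : Prop :=
  C = Submodule.span (ZMod 3) (Set.range fun i : Fin m => fun j : Fin n =>
    Matrix.fromCols (1 : Matrix (Fin m) (Fin m) (ZMod 3)) M i
      (finSumFinEquiv.symm (Fin.cast h j)))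

/-- Pure double circulant codes: generator matrix `(I_m  R)` with `R` circulant. -/
def IsPureDoubleCirculant {n : ℕ} (C : TernaryCode n) : Prop :=
  ∃ (m : ℕ) (h : n = m + m) (R : Matrix (Fin m) (Fin m) (ZMod 3)),
    IsCirculant R ∧ C.IsGeneratedBy h R

/-- Bordered double circulant codes: generator matrix `(I_{k+1}  B)` with `B` a bordered
`k × k` circulant matrix. -/
def IsBorderedDoubleCirculant {n : ℕ} (C : TernaryCode n) : Prop :=
  ∃ (k : ℕ) (h : n = (k + 1) + (k + 1)) (α β γ : ZMod 3) (R : Matrix (Fin k) (Fin k) (ZMod 3)),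
    IsCirculant R ∧ C.IsGeneratedBy h (borderedMatrix α β γ R)

/-- Double circulant codes, pure or bordered. -/
def IsDoubleCirculant {n : ℕ} (C : TernaryCode n) : Prop :=
  C.IsPureDoubleCirculant ∨ C.IsBorderedDoubleCirculant

/-- Double twistulant codes: generator matrix `(I_m  N)` with `N` negacirculant. -/
def IsDoubleTwistulant {n : ℕ} (C : TernaryCode n) : Prop :=
  ∃ (m : ℕ) (h : n = m + m) (N : Matrix (Fin m) (Fin m) (ZMod 3)),
    IsNegacirculant N ∧ C.IsGeneratedBy h N

end TernaryCode

/-! All self-dual [n,n/2,d] codes with the given (n,d) have the same number V of words of weight d.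
It therefore suffices to exhibit codes of the required form with minimum weight d and fewer than V
words of weight d. Such a code is not self-dual, since otherwise it would perform better than
itself.

The value V: a self-dual code has dual distance d, so its restriction to any j < d coordinates is
onto and 3^(k-j) words vanish there. Double counting gives the binomial moments of the weight
distribution (`IsSelfDual.sum_choose`). All weights are divisible by 3, and there are fewer than d
multiples of 3 between d and n. A combination of moments that vanishes at those weights leaves only
the weights 0 and d, and so determines A_d (`IsSelfDual.weightCount_mul`).

The examples: let the generator matrix be (I | M) with M M' = 1. If d ≤ K + K' + 1, a word (a, aM)
of weight at most d has a of weight at most K, or b = aM of weight at most K'; in the second case a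
= bM'. So two enumerations of light vectors suffice, one for M and one for M'
(`weightCount_systematic_le`). Each is certified by one inequality: words of weight d incur a small
penalty and lighter non-zero words a huge one, so a bound on the total penalty bounds the count and
excludes lighter words at once (`lightBound_of_sum_lt`). For circulant and negacirculant M only
words with a 0 = 1 are enumerated; cyclic symmetry and negation supply the rest
(`lightBound_of_symm`).

The enumeration packs a vector over F_3 into two integers in base 256. Its last level tests the
distances from s to all ± rows together, by carry-free integer multiplication
(`le_hammingNorm_of_land_eq_zero`). -/

/-! ### Packed vectors and the enumeration. -/

/-- The number with base-`256` digits `f 0, f 1, …`. -/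
def pack {m : ℕ} (f : Fin m → Bool) : ℕ := ∑ j, (f j).toNat * 256 ^ (j : ℕ)

/-- The positions at which `v` takes the value `c`, packed. -/
def plane {m : ℕ} (c : ZMod 3) (v : Fin m → ZMod 3) : ℕ := pack fun j => decide (v j = c)

/-- The planes of the vectors in a list, reversed and concatenated. -/
def planes {m : ℕ} (c : ZMod 3) : List (Fin m → ZMod 3) → ℕ
  | [] => 0
  | t :: ts => plane c (t ∘ Fin.rev) + 256 ^ m * planes c ts

/-- The digit `v` in the last position of each of `q` blocks of length `m`. -/
def marks (m v : ℕ) : ℕ → ℕ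
  | 0 => 0
  | q + 1 => v * 256 ^ (m - 1) + 256 ^ m * marks m v q

/-- A word of weight `d` contributes `c`; a lighter one, at least `1000000 * c`. -/
def penalty (c t : ℕ) : ℕ := Nat.rec 0 (fun t' _ => Nat.mul c (Nat.succ (Nat.mul 1000000 t'))) t

/-- The contributions of `s`, `s + r` and `s - r` for all rows `r`, where `s` has planes `x, y`. -/
def leafScan (c1 t1 c0 t0 : ℕ) (rows : List (ℕ × ℕ)) (x y : ℕ) : ℕ :=
  List.rec (penalty c1 (Nat.sub t1 (Nat.mod (Nat.lor x y) 255)))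
    (fun r _ ih => Nat.add ih (Nat.add
      (penalty c0 (Nat.sub t0 (Nat.mod (Nat.lor (Nat.xor x r.2) (Nat.xor y r.1)) 255)))
      (penalty c0 (Nat.sub t0 (Nat.mod (Nat.lor (Nat.xor x r.1) (Nat.xor y r.2)) 255)))))
    rows

/-- The value of `leafScan`, where one multiplication by each of `B0, B1, B2` counts the positions
in which `s` agrees with each of the vectors `r, -r`, and the scan is skipped if no count is
large enough. -/
def leafSum (B0 B1 B2 off mask full c1 t1 c0 t0 : ℕ) (rows : List (ℕ × ℕ)) (x y : ℕ) : ℕ :=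
  Nat.rec (penalty c1 (Nat.sub t1 (Nat.mod (Nat.lor x y) 255)))
    (fun _ _ => leafScan c1 t1 c0 t0 rows x y)
    (Nat.land (Nat.add (Nat.add (Nat.mul x B1) (Nat.mul y B2))
      (Nat.add (Nat.mul (Nat.xor full (Nat.lor x y)) B0) off)) mask)

/-- `f` at the planes of `s + r`, where `s` has planes `x, y` and `r` has planes `u, v`. -/
def addPlanes (f : ℕ → ℕ → ℕ) (x y u v : ℕ) : ℕ :=
  (fun t => f (Nat.xor (Nat.lor y v) t) (Nat.xor (Nat.lor x u) t))
    (Nat.xor (Nat.lor x v) (Nat.lor y u))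

/-- The contributions of all sums of `s` and at most `k + 1` of the rows with coefficients `1, -1`,
where `leaf` deals with `k = 0`. -/
def treeSum (d K : ℕ) (leaf : List (ℕ × ℕ) → ℕ → ℕ → ℕ) (k : ℕ) :
    List (ℕ × ℕ) → ℕ → ℕ → ℕ :=
  Nat.rec leaf
    (fun k ih rows => List.rec
      -- Index `k` stands for a budget of `k + 1` rows, so in the successor case `k + 2` choices
      -- remain unused and `K - (k + 2)` rows have been used.
      (fun x y => penalty (60 / (K - (k + 2))) (Nat.sub (d + 1 - K + (k + 2))
        (Nat.mod (Nat.lor x y) 255)))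
      (fun r rs ihr x y => Nat.add (ihr x y) (Nat.add
         (addPlanes (ih rs) x y r.1 r.2) (addPlanes (ih rs) x y r.2 r.1))) rows) k

/-- `f n`, where the kernel evaluates `n` first. -/
def force {α : Type} (n : ℕ) (f : ℕ → α) : α := Nat.rec (f 0) (fun n _ => f (Nat.succ n)) n

/-- `treeSum` with its tables. -/
def search {m : ℕ} (d K : ℕ) (targets : List (Fin m → ZMod 3)) (k : ℕ) (rows : List (ℕ × ℕ))
    (x y : ℕ) : ℕ :=
  force (planes 0 targets) fun B0 => force (planes 1 targets) fun B1 =>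
  force (planes 2 targets) fun B2 => force (marks m (128 + (d + 1 - K) - (m + 1)) targets.length) fun off =>
  force (marks m 128 targets.length) fun mask =>
  force (pack fun _ : Fin m => true) fun full =>
  force (60 / (K - 1)) fun c1 => force (d + 2 - K) fun t1 => force (60 / K) fun c0 =>
  force (d + 1 - K) fun t0 =>
  treeSum d K (leafSum B0 B1 B2 off mask full c1 t1 c0 t0) k rows x y
-- Arithmetic of packed vectors.
theorem pack_succ {m : ℕ} (f : Fin (m + 1) → Bool) :
    pack f = (f 0).toNat + 256 * pack fun j => f j.succ := by
  simp only [pack, Fin.sum_univ_succ, Fin.val_zero, pow_zero, mul_one, Fin.val_succ, pow_succ,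
    Finset.mul_sum]
  congr 1
  exact Finset.sum_congr rfl fun _ _ => by ring

theorem xor_add_mul (a b x y : ℕ) (ha : a < 256) (hb : b < 256) :
    (a + 256 * x) ^^^ (b + 256 * y) = (a ^^^ b) + 256 * (x ^^^ y) := by
  have h1 : ((a + 256 * x) ^^^ (b + 256 * y)) % 2 ^ 8 = a ^^^ b := by
    rw [Nat.xor_mod_two_pow]; congr 1 <;> omega
  have h2 : ((a + 256 * x) ^^^ (b + 256 * y)) / 2 ^ 8 = x ^^^ y := by
    rw [Nat.xor_div_two_pow]; congr 1 <;> omega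
  rw [← h1, ← h2]; exact (Nat.mod_add_div _ (2 ^ 8)).symm

theorem or_add_mul (a b x y : ℕ) (ha : a < 256) (hb : b < 256) :
    (a + 256 * x) ||| (b + 256 * y) = (a ||| b) + 256 * (x ||| y) := by
  have h1 : ((a + 256 * x) ||| (b + 256 * y)) % 2 ^ 8 = a ||| b := by
    rw [Nat.or_mod_two_pow]; congr 1 <;> omega
  have h2 : ((a + 256 * x) ||| (b + 256 * y)) / 2 ^ 8 = x ||| y := by
    rw [Nat.or_div_two_pow]; congr 1 <;> omega
  rw [← h1, ← h2]; exact (Nat.mod_add_div _ (2 ^ 8)).symm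

theorem toNat_lt_256 (b : Bool) : b.toNat < 256 := by cases b <;> decide

theorem pack_xor {m : ℕ} (f g : Fin m → Bool) :
    pack f ^^^ pack g = pack fun j => f j ^^ g j := by
  induction m with
  | zero => simp [pack]
  | succ m ih =>
    rw [pack_succ f, pack_succ g, pack_succ (fun j => f j ^^ g j),
      xor_add_mul _ _ _ _ (toNat_lt_256 _) (toNat_lt_256 _), ih]
    congr 1
    cases f 0 <;> cases g 0 <;> rfl

theorem pack_or {m : ℕ} (f g : Fin m → Bool) :
    pack f ||| pack g = pack fun j => f j || g j := by
  induction m with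
  | zero => simp [pack]
  | succ m ih =>
    rw [pack_succ f, pack_succ g, pack_succ (fun j => f j || g j),
      or_add_mul _ _ _ _ (toNat_lt_256 _) (toNat_lt_256 _), ih]
    congr 1
    cases f 0 <;> cases g 0 <;> rfl

/-- Since 256 ≡ 1 mod 255, reduction gives the digit sum, which is at most m < 255. -/
theorem pack_mod {m : ℕ} (hm : m < 255) (f : Fin m → Bool) :
    pack f % 255 = ∑ j, (f j).toNat := by
  have h : pack f ≡ ∑ j, (f j).toNat [MOD 255] := by
    unfold pack
    refine Nat.ModEq.sum fun j _ => ?_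
    have : 256 ^ (j : ℕ) ≡ 1 ^ (j : ℕ) [MOD 255] := Nat.ModEq.pow _ (by decide)
    simpa using this.mul_left (f j).toNat
  have hle : ∑ j, (f j).toNat ≤ m := by
    calc ∑ j, (f j).toNat ≤ ∑ _j : Fin m, 1 :=
          Finset.sum_le_sum fun j _ => by cases f j <;> decide
      _ = m := by simp
  rw [h, Nat.mod_eq_of_lt (by omega)]

theorem hammingNorm_eq_sum {m : ℕ} (v : Fin m → ZMod 3) :
    hammingNorm v = ∑ j, (decide (v j ≠ 0)).toNat := by
  simp only [hammingNorm, Finset.card_filter]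
  exact Finset.sum_congr rfl fun j _ => by by_cases h : v j = 0 <;> simp [h]

theorem planes_mod {m : ℕ} (hm : m < 255) (s : Fin m → ZMod 3) :
    (plane 1 s ||| plane 2 s) % 255 = hammingNorm s := by
  rw [plane, plane, pack_or, pack_mod hm, hammingNorm_eq_sum]
  exact Finset.sum_congr rfl fun j _ => by generalize s j = a; revert a; decide

/-- A coordinate of s + r vanishes exactly when s = 1 ⇔ r = 2 and s = 2 ⇔ r = 1 there, so the weight
needs only two exclusive ors and one or. -/
theorem planes_mod_add {m : ℕ} (hm : m < 255) (s r : Fin m → ZMod 3) :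
    ((plane 1 s ^^^ plane 2 r) ||| (plane 2 s ^^^ plane 1 r)) % 255 = hammingNorm (s + r) := by
  simp only [plane, pack_or, pack_xor]
  rw [pack_mod hm, hammingNorm_eq_sum]
  refine Finset.sum_congr rfl fun j _ => ?_
  rw [Pi.add_apply]
  generalize s j = a; generalize r j = b; revert a b; decide

theorem plane_neg {m : ℕ} (r : Fin m → ZMod 3) :
    plane 1 (-r) = plane 2 r ∧ plane 2 (-r) = plane 1 r := by
  constructor <;>
  · refine congrArg pack (funext fun j => ?_)
    rw [Pi.neg_apply]
    generalize r j = b; revert b; decide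

theorem planes_mod_sub {m : ℕ} (hm : m < 255) (s r : Fin m → ZMod 3) :
    ((plane 1 s ^^^ plane 1 r) ||| (plane 2 s ^^^ plane 2 r)) % 255 = hammingNorm (s - r) := by
  rw [sub_eq_add_neg, ← planes_mod_add hm, (plane_neg r).1, (plane_neg r).2]

theorem addPlanes_add {m : ℕ} (f : ℕ → ℕ → ℕ) (s r : Fin m → ZMod 3) :
    addPlanes f (plane 1 s) (plane 2 s) (plane 1 r) (plane 2 r) =
      f (plane 1 (s + r)) (plane 2 (s + r)) := by
  change f ((plane 2 s ||| plane 2 r) ^^^ ((plane 1 s ||| plane 2 r) ^^^ (plane 2 s ||| plane 1 r)))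
    ((plane 1 s ||| plane 1 r) ^^^ ((plane 1 s ||| plane 2 r) ^^^ (plane 2 s ||| plane 1 r))) = _
  simp only [plane, pack_or, pack_xor]
  congr 1 <;>
  · refine congrArg pack (funext fun j => ?_)
    rw [Pi.add_apply]
    generalize s j = a; generalize r j = b; revert a b; decide

theorem addPlanes_sub {m : ℕ} (f : ℕ → ℕ → ℕ) (s r : Fin m → ZMod 3) :
    addPlanes f (plane 1 s) (plane 2 s) (plane 2 r) (plane 1 r) =
      f (plane 1 (s - r)) (plane 2 (s - r)) := by
  rw [sub_eq_add_neg, ← addPlanes_add f, (plane_neg r).1, (plane_neg r).2]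

/-! ### The enumeration as a recursion on vectors. -/

/-- The contributions of all sums of `s` and at most `k` of the rows with coefficients `1, -1`. -/
def wordSum {m : ℕ} (d K : ℕ) : List (Fin m → ZMod 3) → ℕ → (Fin m → ZMod 3) → ℕ
  | [], k, s => penalty (60 / (K - k)) (d + 1 - K + k - hammingNorm s)
  | _ :: _, 0, s => penalty (60 / K) (d + 1 - K - hammingNorm s)
  | r :: rs, k + 1, s =>
      wordSum d K rs (k + 1) s + (wordSum d K rs k (s + r) + wordSum d K rs k (s - r))

/-- The first two planes of a vector. -/
def encode {m : ℕ} (r : Fin m → ZMod 3) : ℕ × ℕ := (plane 1 r, plane 2 r)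

theorem wordSum_zero {m : ℕ} (d K : ℕ) (rs : List (Fin m → ZMod 3)) (s : Fin m → ZMod 3) :
    wordSum d K rs 0 s = penalty (60 / K) (d + 1 - K - hammingNorm s) := by
  cases rs <;> rfl

theorem leafScan_eq {m : ℕ} (hm : m < 255) {d K : ℕ} (hK : K ≤ d)
    (rs : List (Fin m → ZMod 3)) (s : Fin m → ZMod 3) :
    leafScan (60 / (K - 1)) (d + 2 - K) (60 / K) (d + 1 - K) (rs.map encode)
      (plane 1 s) (plane 2 s) = wordSum d K rs 1 s := by
  induction rs with
  | nil =>
    change penalty _ (d + 2 - K - (plane 1 s ||| plane 2 s) % 255) = _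
    rw [planes_mod hm, wordSum, show d + 2 - K = d + 1 - K + 1 by omega]
  | cons r rs ih =>
    rw [wordSum, wordSum_zero, wordSum_zero, ← ih, ← planes_mod_add hm, ← planes_mod_sub hm]
    rfl

theorem treeSum_eq {m : ℕ} (hm : m < 255) {d K : ℕ} {leaf : List (ℕ × ℕ) → ℕ → ℕ → ℕ}
    (R : List (Fin m → ZMod 3))
    (hleaf : ∀ rs : List (Fin m → ZMod 3), rs ⊆ R → ∀ s,
      leaf (rs.map encode) (plane 1 s) (plane 2 s) = wordSum d K rs 1 s)
    (k : ℕ) (rs : List (Fin m → ZMod 3)) (hrs : rs ⊆ R) (s : Fin m → ZMod 3) :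
    treeSum d K leaf k (rs.map encode) (plane 1 s) (plane 2 s) = wordSum d K rs (k + 1) s := by
  induction k generalizing rs s with
  | zero => exact hleaf rs hrs s
  | succ k ih =>
    induction rs generalizing s with
    | nil =>
      change penalty (60 / (K - (k + 2))) (d + 1 - K + (k + 2) -
        (plane 1 s ||| plane 2 s) % 255) = _
      rw [planes_mod hm, wordSum]
    | cons r rs ihr =>
      have hrs' : rs ⊆ R := fun _ h => hrs (List.mem_cons_of_mem _ h)
      rw [wordSum, ← ihr hrs', ← ih rs hrs', ← ih rs hrs',
        ← addPlanes_add (treeSum d K leaf k (rs.map encode)),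
        ← addPlanes_sub (treeSum d K leaf k (rs.map encode))]
      rfl

/-! ### Products of packed vectors without carries. -/

section Digits

open Polynomial

/-- Coefficients below B cause no carries, so they are the base-B digits of the value at B. -/
theorem eval_div_pow_mod {B : ℕ} (p : ℕ[X]) (h : ∀ i, p.coeff i < B) (i : ℕ) :
    p.eval B / B ^ i % B = p.coeff i := by
  have hB : 0 < B := (Nat.zero_le _).trans_lt (h 0)
  have hp (q : ℕ[X]) : q.eval B = B * q.divX.eval B + q.coeff 0 := by
    conv_lhs => rw [← q.divX_mul_X_add]
    simp [mul_comm]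
  induction i generalizing p with
  | zero => rw [hp p, pow_zero, Nat.div_one, Nat.mul_add_mod, Nat.mod_eq_of_lt (h 0)]
  | succ i ih =>
    rw [pow_succ', ← Nat.div_div_eq_div_mul, hp p, Nat.mul_add_div hB,
      Nat.div_eq_of_lt (h 0), add_zero, ih _ fun j => by rw [coeff_divX]; exact h _, coeff_divX]

/-- The polynomial with value `pack f` at `256`. -/
noncomputable def packPoly {m : ℕ} (f : Fin m → Bool) : ℕ[X] :=
  ∑ j, C (f j).toNat * X ^ (j : ℕ)

theorem eval_packPoly {m : ℕ} (f : Fin m → Bool) : (packPoly f).eval 256 = pack f := by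
  simp [packPoly, pack, eval_finsetSum]

theorem coeff_packPoly {m : ℕ} (f : Fin m → Bool) (i : Fin m) :
    (packPoly f).coeff i = (f i).toNat := by
  simp [packPoly, coeff_X_pow, Fin.val_inj]

theorem coeff_packPoly_of_le {m : ℕ} (f : Fin m → Bool) {n : ℕ} (hn : m ≤ n) :
    (packPoly f).coeff n = 0 := by
  rw [packPoly, finsetSum_coeff]
  refine Finset.sum_eq_zero fun j _ => ?_
  rw [coeff_C_mul, coeff_X_pow, if_neg (by omega), mul_zero]

theorem coeff_packPoly_mul {m : ℕ} (f : Fin m → Bool) (q : ℕ[X]) (n : ℕ) :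
    (packPoly f * q).coeff n =
      ∑ j : Fin m, (f j).toNat * if (j : ℕ) ≤ n then q.coeff (n - j) else 0 := by
  simp only [packPoly, Finset.sum_mul, finsetSum_coeff, mul_assoc, coeff_C_mul, coeff_X_pow_mul']

/-- The polynomial with value `planes c ts` at `256`. -/
noncomputable def planesPoly {m : ℕ} (c : ZMod 3) : List (Fin m → ZMod 3) → ℕ[X]
  | [] => 0
  | t :: ts => packPoly (fun j => decide ((t ∘ Fin.rev) j = c)) + X ^ m * planesPoly c ts

theorem eval_planesPoly {m : ℕ} (c : ZMod 3) (ts : List (Fin m → ZMod 3)) :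
    (planesPoly c ts).eval 256 = planes c ts := by
  induction ts with
  | nil => simp [planesPoly, planes]
  | cons t ts ih => simp [planesPoly, planes, plane, ih, eval_packPoly]

theorem coeff_planesPoly_le {m : ℕ} (c : ZMod 3) (ts : List (Fin m → ZMod 3)) (n : ℕ) :
    (planesPoly c ts).coeff n ≤ 1 := by
  induction ts generalizing n with
  | nil => simp [planesPoly]
  | cons t ts ih =>
    rw [planesPoly, coeff_add, coeff_X_pow_mul']
    split_ifs with h
    · rw [coeff_packPoly_of_le _ h, zero_add]; exact ih _
    · rw [add_zero]
      exact (coeff_packPoly _ ⟨n, not_le.1 h⟩).le.trans (Bool.toNat_le _)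

theorem coeff_planesPoly {m : ℕ} (c : ZMod 3) (ts : List (Fin m → ZMod 3)) (b : ℕ)
    (hb : b < ts.length) (i : Fin m) :
    (planesPoly c ts).coeff (m * b + i) = (decide (ts[b] i.rev = c)).toNat := by
  induction ts generalizing b with
  | nil => simp at hb
  | cons t ts ih =>
    rw [planesPoly, coeff_add, coeff_X_pow_mul']
    cases b with
    | zero =>
      rw [if_neg (by have := i.2; omega), mul_zero, zero_add, coeff_packPoly]
      simp
    | succ b =>
      have h : m * (b + 1) + (i : ℕ) = m * b + i + m := by ring
      rw [if_pos (by omega), coeff_packPoly_of_le _ (by omega), zero_add, h,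
        Nat.add_sub_cancel, ih b (by simpa using hb)]
      simp

theorem coeff_packPoly_mul_le {m : ℕ} (f : Fin m → Bool) (c : ZMod 3)
    (ts : List (Fin m → ZMod 3)) (n : ℕ) : (packPoly f * planesPoly c ts).coeff n ≤ m := by
  rw [coeff_packPoly_mul]
  calc _ ≤ ∑ _j : Fin m, 1 := Finset.sum_le_sum fun j _ => by
        refine (Nat.mul_le_mul (Bool.toNat_le _) (?_ : _ ≤ 1)).trans_eq (mul_one 1)
        split_ifs
        · exact coeff_planesPoly_le c ts _
        · exact zero_le_one
    _ = m := by simp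

/-- Each block is stored reversed, so convolution becomes an inner product at the last position of
block b. For j < m the index m b + (m - 1) - j stays inside that block, so other blocks do not
interfere. -/
theorem coeff_packPoly_mul_planesPoly {m : ℕ} (f : Fin m → Bool) (c : ZMod 3)
    (ts : List (Fin m → ZMod 3)) (b : ℕ) (hb : b < ts.length) :
    (packPoly f * planesPoly c ts).coeff (m * b + (m - 1)) =
      ∑ j, (f j).toNat * (decide (ts[b] j = c)).toNat := by
  rw [coeff_packPoly_mul]
  refine Finset.sum_congr rfl fun j _ => ?_
  have hj := j.2
  have h : m * b + (m - 1) - (j : ℕ) = m * b + (j.rev : ℕ) := by rw [Fin.val_rev]; omega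
  rw [if_pos (by omega), h, coeff_planesPoly c ts b hb, Fin.rev_rev]

/-- The polynomial with value `marks m v q` at `256`. -/
noncomputable def marksPoly (m v : ℕ) : ℕ → ℕ[X]
  | 0 => 0
  | q + 1 => C v * X ^ (m - 1) + X ^ m * marksPoly m v q

theorem eval_marksPoly (m v q : ℕ) : (marksPoly m v q).eval 256 = marks m v q := by
  induction q with
  | zero => simp [marksPoly, marks]
  | succ q ih => simp [marksPoly, marks, ih]

theorem coeff_marksPoly_le {m : ℕ} (hm : 0 < m) (v q n : ℕ) : (marksPoly m v q).coeff n ≤ v := by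
  induction q generalizing n with
  | zero => simp [marksPoly]
  | succ q ih =>
    rw [marksPoly, coeff_add, coeff_X_pow_mul', coeff_C_mul, coeff_X_pow]
    split_ifs with h1 h2
    · omega
    · simp
    · simpa using ih _
    · simp

theorem coeff_marksPoly {m : ℕ} (hm : 0 < m) (v q b : ℕ) (hb : b < q) :
    (marksPoly m v q).coeff (m * b + (m - 1)) = v := by
  induction q generalizing b with
  | zero => simp at hb
  | succ q ih =>
    rw [marksPoly, coeff_add, coeff_X_pow_mul', coeff_C_mul, coeff_X_pow]
    cases b with
    | zero => rw [mul_zero, zero_add, if_pos rfl, if_neg (by omega)]; simp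
    | succ b =>
      have h : m * (b + 1) + (m - 1) = m * b + (m - 1) + m := by ring
      have h0 : m * b + (m - 1) + m ≠ m - 1 := by omega
      rw [h, if_neg h0, if_pos (by omega), Nat.add_sub_cancel, ih b (by omega)]
      simp

theorem digit_lt_of_land_eq_zero {W M : ℕ} (h : W &&& M = 0) (i : ℕ)
    (hM : M / 256 ^ i % 256 = 128) : W / 256 ^ i % 256 < 128 := by
  have key : (W / 256 ^ i % 256) &&& 128 = 0 := by
    have e : (256 : ℕ) ^ i = 2 ^ (8 * i) := by rw [pow_mul]; norm_num
    have e' : (256 : ℕ) = 2 ^ 8 := by norm_num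
    rw [← hM, e, e', ← Nat.and_mod_two_pow, ← Nat.and_div_two_pow, h]
    simp
  have hlt : W / 256 ^ i % 256 < 256 := Nat.mod_lt _ (by norm_num)
  revert key hlt
  generalize W / 256 ^ i % 256 = x
  intro h1 h2
  have : ∀ x < 256, x &&& 128 = 0 → x < 128 := by decide +kernel
  exact this x h2 h1

end Digits

theorem xor_planes {m : ℕ} (s : Fin m → ZMod 3) :
    (pack fun _ : Fin m => true) ^^^ (plane 1 s ||| plane 2 s) = plane 0 s := by
  simp only [plane, pack_or, pack_xor]
  refine congrArg pack (funext fun j => ?_)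
  generalize s j = a; revert a; decide

/-- Each coordinate is either an agreement, in exactly one of the three values, or contributes 1 to
the distance. -/
theorem sum_agree {m : ℕ} (s t : Fin m → ZMod 3) :
    ∑ j, (decide (s j = 1)).toNat * (decide (t j = 1)).toNat +
      ∑ j, (decide (s j = 2)).toNat * (decide (t j = 2)).toNat +
      ∑ j, (decide (s j = 0)).toNat * (decide (t j = 0)).toNat + hammingNorm (s - t) = m := by
  rw [hammingNorm_eq_sum, ← Finset.sum_add_distrib, ← Finset.sum_add_distrib,
    ← Finset.sum_add_distrib]
  have h : ∀ a b : ZMod 3, (decide (a = 1)).toNat * (decide (b = 1)).toNat +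
      (decide (a = 2)).toNat * (decide (b = 2)).toNat +
      (decide (a = 0)).toNat * (decide (b = 0)).toNat + (decide (a - b ≠ 0)).toNat = 1 := by
    decide
  simp only [Pi.sub_apply, h]
  simp

/-- The digit at the end of the block of t is the number of agreements of s and t plus the offset,
that is, 127 + t0 minus their distance. Its bit 128 is clear exactly when the distance is at least
t0. -/
theorem le_hammingNorm_of_land_eq_zero {m : ℕ} (hm : 0 < m) (hm' : 3 * m ≤ 126) {t0 : ℕ}
    (ht0 : t0 ≤ m) (ts : List (Fin m → ZMod 3)) (s : Fin m → ZMod 3)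
    (h : (plane 1 s * planes 1 ts + plane 2 s * planes 2 ts +
      (plane 0 s * planes 0 ts + marks m (128 + t0 - (m + 1)) ts.length)) &&&
        marks m 128 ts.length = 0) (t : Fin m → ZMod 3) (ht : t ∈ ts) :
    t0 ≤ hammingNorm (s - t) := by
  obtain ⟨b, hb, rfl⟩ := List.getElem_of_mem ht
  set P : Polynomial ℕ :=
    packPoly (fun j => decide (s j = 1)) * planesPoly 1 ts +
      packPoly (fun j => decide (s j = 2)) * planesPoly 2 ts +
      (packPoly (fun j => decide (s j = 0)) * planesPoly 0 ts +
        marksPoly m (128 + t0 - (m + 1)) ts.length) with hP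
  have hev : P.eval 256 = plane 1 s * planes 1 ts + plane 2 s * planes 2 ts +
      (plane 0 s * planes 0 ts + marks m (128 + t0 - (m + 1)) ts.length) := by
    simp only [hP, Polynomial.eval_add, Polynomial.eval_mul, eval_packPoly, eval_planesPoly,
      eval_marksPoly, plane]
  -- The three products give at most 3m ≤ 126, and the offset is at most 127 because t0 ≤ m.
  have hlt : ∀ i, P.coeff i < 256 := fun i => by
    have h1 := coeff_packPoly_mul_le (fun j => decide (s j = 1)) 1 ts i
    have h2 := coeff_packPoly_mul_le (fun j => decide (s j = 2)) 2 ts i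
    have h3 := coeff_packPoly_mul_le (fun j => decide (s j = 0)) 0 ts i
    have h4 := coeff_marksPoly_le hm (128 + t0 - (m + 1)) ts.length i
    simp only [hP, Polynomial.coeff_add]
    omega
  have hM : marks m 128 ts.length / 256 ^ (m * b + (m - 1)) % 256 = 128 := by
    rw [← eval_marksPoly, eval_div_pow_mod, coeff_marksPoly hm _ _ _ hb]
    exact fun i => (coeff_marksPoly_le hm 128 _ i).trans_lt (by norm_num)
  rw [← hev] at h
  have := digit_lt_of_land_eq_zero h _ hM
  rw [eval_div_pow_mod P hlt] at this
  simp only [hP, Polynomial.coeff_add, coeff_packPoly_mul_planesPoly _ _ _ _ hb,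
    coeff_marksPoly hm _ _ _ hb] at this
  have := sum_agree s ts[b]
  omega

/-! ### Correctness of the enumeration. -/

theorem penalty_zero (c : ℕ) : penalty c 0 = 0 := rfl

theorem wordSum_one_eq {m : ℕ} {d K : ℕ} (rs : List (Fin m → ZMod 3)) (s : Fin m → ZMod 3)
    (h : ∀ r ∈ rs, d + 1 - K ≤ hammingNorm (s - r) ∧ d + 1 - K ≤ hammingNorm (s - -r)) :
    wordSum d K rs 1 s = penalty (60 / (K - 1)) (d + 1 - K + 1 - hammingNorm s) := by
  induction rs with
  | nil => rw [wordSum]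
  | cons r rs ih =>
    have hr := h r List.mem_cons_self
    rw [sub_neg_eq_add] at hr
    rw [wordSum, wordSum_zero, wordSum_zero, Nat.sub_eq_zero_of_le hr.1,
      Nat.sub_eq_zero_of_le hr.2, penalty_zero, ih fun r' h' => h r' (List.mem_cons_of_mem _ h'), add_zero, add_zero]

/-- If the mask test gives 0, every s ± r has weight at least d + 1 - K. Its penalty is then 0, so
skipping the scan loses nothing. The test runs over all of R, which only makes skipping rarer. -/
theorem leafSum_eq {m : ℕ} (hm : 0 < m) (hm' : 3 * m ≤ 126) {d K : ℕ} (hK : K ≤ d)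
    (hd : d + 1 - K ≤ m) (R : List (Fin m → ZMod 3)) (rs : List (Fin m → ZMod 3)) (hrs : rs ⊆ R)
    (s : Fin m → ZMod 3) :
    leafSum (planes 0 (R ++ R.map Neg.neg)) (planes 1 (R ++ R.map Neg.neg))
      (planes 2 (R ++ R.map Neg.neg))
      (marks m (128 + (d + 1 - K) - (m + 1)) (R ++ R.map Neg.neg).length)
      (marks m 128 (R ++ R.map Neg.neg).length) (pack fun _ : Fin m => true)
      (60 / (K - 1)) (d + 2 - K) (60 / K) (d + 1 - K) (rs.map encode) (plane 1 s) (plane 2 s) =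
    wordSum d K rs 1 s := by
  set ts := R ++ R.map Neg.neg
  have key : ∀ n : ℕ, n = ((plane 1 s * planes 1 ts + plane 2 s * planes 2 ts +
      (plane 0 s * planes 0 ts + marks m (128 + (d + 1 - K) - (m + 1)) ts.length)) &&&
        marks m 128 ts.length) →
      (Nat.rec (penalty (60 / (K - 1)) (d + 2 - K - (plane 1 s ||| plane 2 s) % 255))
        (fun _ _ => leafScan (60 / (K - 1)) (d + 2 - K) (60 / K) (d + 1 - K) (rs.map encode)
          (plane 1 s) (plane 2 s)) n : ℕ) = wordSum d K rs 1 s := by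
    intro n hn
    cases n with
    | zero =>
      have h := le_hammingNorm_of_land_eq_zero hm hm' hd ts s hn.symm
      rw [wordSum_one_eq rs s fun r hr => ⟨h r (List.mem_append_left _ (hrs hr)),
        h (-r) (List.mem_append_right _ (List.mem_map_of_mem (hrs hr)))⟩]
      change penalty _ (d + 2 - K - (plane 1 s ||| plane 2 s) % 255) = _
      rw [planes_mod (by omega), show d + 2 - K = d + 1 - K + 1 by omega]
    | succ n => exact leafScan_eq (by omega) hK rs s
  refine key _ ?_
  rw [← xor_planes]
  rfl

theorem force_eq {α : Type} (n : ℕ) (f : ℕ → α) : force n f = f n := by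
  cases n <;> rfl

theorem search_eq {m : ℕ} (hm : 0 < m) (hm' : 3 * m ≤ 126) {d K : ℕ} (hK : K ≤ d)
    (hd : d + 1 - K ≤ m) (R : List (Fin m → ZMod 3)) (k : ℕ) (rs : List (Fin m → ZMod 3))
    (hrs : rs ⊆ R) (s : Fin m → ZMod 3) :
    search d K (R ++ R.map Neg.neg) k (rs.map encode) (plane 1 s) (plane 2 s) =
      wordSum d K rs (k + 1) s := by
  simp only [search, force_eq]
  exact treeSum_eq (by omega) R (fun rs hrs s => leafSum_eq hm hm' hK hd R rs hrs s) k rs hrs s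

theorem hammingNorm_cons {p : ℕ} (x : ZMod 3) (a : Fin p → ZMod 3) :
    hammingNorm (Fin.cons x a : Fin (p + 1) → ZMod 3) =
      (if x = 0 then 0 else 1) + hammingNorm a := by
  rw [hammingNorm_eq_sum, hammingNorm_eq_sum, Fin.sum_univ_succ]
  simp only [Fin.cons_zero, Fin.cons_succ]
  congr 1
  by_cases h : x = 0 <;> simp [h]

theorem sum_cons {p : ℕ} {A : Type*} [AddCommMonoid A] (f : (Fin (p + 1) → ZMod 3) → A) :
    ∑ a, f a = ∑ a, f (Fin.cons 0 a) + (∑ a, f (Fin.cons 1 a) + ∑ a, f (Fin.cons (-1) a)) := by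
  rw [← (Fin.consEquiv fun _ => ZMod 3).sum_comp f, Fintype.sum_prod_type]
  have h : ∀ g : ZMod 3 → A, ∑ x, g x = g 0 + (g 1 + g (-1)) := fun g => by
    rw [← add_assoc]; exact Fin.sum_univ_three g
  rw [h]
  rfl

theorem cons_vecMul_ofFn {p m : ℕ} (x : ZMod 3) (a : Fin p → ZMod 3)
    (M : Fin (p + 1) → Fin m → ZMod 3) :
    Matrix.vecMul (Fin.cons x a : Fin (p + 1) → ZMod 3) (Matrix.of M) =
      x • M 0 + Matrix.vecMul a (Matrix.of fun i => M i.succ) := by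
  ext j
  simp [Matrix.vecMul, dotProduct, Fin.sum_univ_succ]

/-- The paths of the recursion are the coefficient vectors a of weight at most k. At the end of a
path k - wt(a) of the budget is left, so K - (k - wt(a)) counts all rows used, including K - k used
beforehand. -/
theorem wordSum_eq_sum {m : ℕ} (d K : ℕ) {p : ℕ} (M : Fin p → Fin m → ZMod 3) (k : ℕ)
    (s : Fin m → ZMod 3) :
    wordSum d K (List.ofFn M) k s =
      ∑ a : Fin p → ZMod 3, if hammingNorm a ≤ k then
        penalty (60 / (K - (k - hammingNorm a)))
          (d + 1 - K + (k - hammingNorm a) - hammingNorm (s + Matrix.vecMul a (Matrix.of M))) else 0 := by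
  induction p generalizing k s with
  | zero =>
    have h : ∀ a : Fin 0 → ZMod 3, hammingNorm a = 0 ∧ Matrix.vecMul a (Matrix.of M) = 0 := fun a =>
      ⟨by rw [Subsingleton.elim a 0, hammingNorm_zero], by rw [Subsingleton.elim a 0, Matrix.zero_vecMul]⟩
    simp [h, wordSum]
  | succ p ih =>
    rw [List.ofFn_succ]
    cases k with
    | zero =>
      rw [Fintype.sum_eq_single 0]
      · simp [wordSum]
      · intro a ha
        rw [if_neg]
        rwa [Nat.le_zero, hammingNorm_eq_zero]
    | succ k =>
      rw [wordSum, ih, ih, ih, sum_cons]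
      simp only [hammingNorm_cons, cons_vecMul_ofFn]
      have h1 : (1 : ZMod 3) ≠ 0 := by decide
      have h2 : (-1 : ZMod 3) ≠ 0 := by decide
      simp only [if_true, if_neg h1, if_neg h2, zero_smul, one_smul, neg_smul, zero_add,
        ← add_assoc, sub_eq_add_neg, add_comm 1 (hammingNorm _), Nat.add_le_add_iff_right,
        Nat.add_sub_add_right]

/-! ### From a bound on the total penalty to a bound on light words. -/

/-- The contribution of the codeword `(a, a M)`. -/
def wordPenalty {m : ℕ} (d : ℕ) (M : Matrix (Fin m) (Fin m) (ZMod 3)) (a : Fin m → ZMod 3) : ℕ :=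
  penalty (60 / hammingNorm a) (d + 1 - hammingNorm a - hammingNorm (Matrix.vecMul a M))

/-- Every non-zero codeword `(a, a M)` with `a` of weight at most `K` has weight at least `d`, and
at most `N` of them have weight `d`. -/
def LightBound {m : ℕ} (d K : ℕ) (M : Matrix (Fin m) (Fin m) (ZMod 3)) (N : ℕ) : Prop :=
  (∀ a : Fin m → ZMod 3, a ≠ 0 → hammingNorm a ≤ K →
    d ≤ hammingNorm a + hammingNorm (Matrix.vecMul a M)) ∧
  (Finset.univ.filter fun a : Fin m → ZMod 3 => a ≠ 0 ∧ hammingNorm a ≤ K ∧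
    hammingNorm a + hammingNorm (Matrix.vecMul a M) = d).card ≤ N

theorem le_penalty {c t : ℕ} (ht : 0 < t) : c ≤ penalty c t := by
  obtain ⟨t, rfl⟩ := Nat.exists_eq_succ_of_ne_zero ht.ne'
  exact Nat.le_mul_of_pos_right c (Nat.succ_pos _)

theorem le_penalty_of_two_le {c t : ℕ} (ht : 2 ≤ t) : c * 1000000 ≤ penalty c t := by
  obtain ⟨t, rfl⟩ := Nat.exists_eq_add_of_le' ht
  exact Nat.mul_le_mul_left c (by
    change 1000000 ≤ Nat.succ (1000000 * (t + 1))
    omega)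

/-- A `LightBound` from a bound for a sum in which the words have weights `f a ≥ e`. -/
theorem lightBound_of_sum_lt {m : ℕ} {d K : ℕ} (M : Matrix (Fin m) (Fin m) (ZMod 3)) {N e : ℕ}
    (f : (Fin m → ZMod 3) → ℕ)
    (hf : ∀ a, a ≠ 0 → hammingNorm a ≤ K → e ≤ f a * (60 / hammingNorm a))
    (h : ∑ a : Fin m → ZMod 3, (if hammingNorm a ≤ K then f a * wordPenalty d M a else 0) <
      e * (N + 1)) (hN : N + 1 ≤ 1000000) : LightBound d K M N := by
  constructor
  · intro a ha haK
    by_contra! hlt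
    have h1 : f a * wordPenalty d M a ≤
        ∑ a : Fin m → ZMod 3, (if hammingNorm a ≤ K then f a * wordPenalty d M a else 0) := by
      refine le_trans (le_of_eq ?_) (Finset.single_le_sum (f := fun a : Fin m → ZMod 3 =>
        if hammingNorm a ≤ K then f a * wordPenalty d M a else 0)
        (fun _ _ => Nat.zero_le _) (Finset.mem_univ a))
      simp [haK]
    -- A word lighter than d has deficiency d + 1 - weight at least 2. Its penalty alone exceeds the
    -- assumed bound, as N + 1 ≤ 1000000.
    have h2 : 60 / hammingNorm a * 1000000 ≤ wordPenalty d M a :=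
      le_penalty_of_two_le (by omega)
    have h3 : e * 1000000 ≤ f a * wordPenalty d M a := by
      calc e * 1000000 ≤ f a * (60 / hammingNorm a) * 1000000 :=
            Nat.mul_le_mul_right _ (hf a ha haK)
        _ = f a * (60 / hammingNorm a * 1000000) := mul_assoc _ _ _
        _ ≤ _ := Nat.mul_le_mul_left _ h2
    have h4 : e * (N + 1) ≤ e * 1000000 := Nat.mul_le_mul_left _ hN
    omega
  · set S := Finset.univ.filter fun a : Fin m → ZMod 3 => a ≠ 0 ∧ hammingNorm a ≤ K ∧
      hammingNorm a + hammingNorm (Matrix.vecMul a M) = d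
    have h1 : S.card * e ≤
        ∑ a : Fin m → ZMod 3, (if hammingNorm a ≤ K then f a * wordPenalty d M a else 0) := by
      rw [← smul_eq_mul]
      refine (Finset.card_nsmul_le_sum S (fun a => if hammingNorm a ≤ K then
        f a * wordPenalty d M a else 0) e fun a ha => ?_).trans
        (Finset.sum_le_sum_of_subset (Finset.subset_univ S))
      obtain ⟨ha0, haK, had⟩ := (Finset.mem_filter.1 ha).2
      simp only [haK, if_true]
      exact (hf a ha0 haK).trans (Nat.mul_le_mul_left _ (le_penalty (by omega)))
    rw [mul_comm] at h1
    exact Nat.lt_succ_iff.1 (lt_of_mul_lt_mul_left' (h1.trans_lt h))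

/-- Without symmetry every non-zero a of weight at most K is charged at least 60 / K per word of
weight d, so N may exceed the true count. The word a = 0 costs nothing because 60 / 0 = 0. -/
theorem lightBound_of_wordSum_lt {m : ℕ} {d K : ℕ} (hK : K ≤ d)
    (M : Matrix (Fin m) (Fin m) (ZMod 3)) {N : ℕ} (hN : N + 1 ≤ 1000000)
    (h : wordSum d K (List.ofFn M.row) K 0 < 60 / K * (N + 1)) : LightBound d K M N := by
  refine lightBound_of_sum_lt M (fun _ => 1) (e := 60 / K) (fun a ha haK => ?_) ?_ hN
  · rw [one_mul]
    exact Nat.div_le_div_left haK (hammingNorm_pos_iff.2 ha)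
  · refine lt_of_eq_of_lt ?_ h
    rw [wordSum_eq_sum]
    refine Finset.sum_congr rfl fun a _ => ?_
    change _ = if _ then penalty _ (_ - hammingNorm (0 + Matrix.vecMul a M)) else 0
    split_ifs with haK
    · rw [one_mul, wordPenalty, zero_add]
      congr 2 <;> omega
    · rfl

/-! ### Use of cyclic symmetry. -/

section Symmetric

variable {n : ℕ} {M : Matrix (Fin (n + 1)) (Fin (n + 1)) (ZMod 3)} {τ : Fin (n + 1) → ZMod 3}

/-- The shift of a vector by one place, combined with multiplication by `τ`. -/
def twistShift (τ : Fin (n + 1) → ZMod 3) (a : Fin (n + 1) → ZMod 3) : Fin (n + 1) → ZMod 3 :=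
  fun j => τ (j - 1) * a (j - 1)

theorem twistShift_add_one (a : Fin (n + 1) → ZMod 3) (j : Fin (n + 1)) :
    twistShift τ a (j + 1) = τ j * a j := by
  simp [twistShift]

theorem mul_eq_zero_of_sq_eq_one {t x : ZMod 3} (ht : t * t = 1) : t * x = 0 ↔ x = 0 := by
  revert t x; decide

theorem twistShift_bijective (hτ : ∀ i, τ i * τ i = 1) : Function.Bijective (twistShift τ) := by
  refine Finite.injective_iff_bijective.1 fun a b hab => funext fun j => ?_
  have h := congrFun hab (j + 1)
  rw [twistShift_add_one, twistShift_add_one] at h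
  have := congrArg (τ j * ·) h
  simpa only [← mul_assoc, hτ, one_mul] using this

theorem hammingNorm_twistShift (hτ : ∀ i, τ i * τ i = 1) (a : Fin (n + 1) → ZMod 3) :
    hammingNorm (twistShift τ a) = hammingNorm a := by
  rw [hammingNorm_eq_sum, hammingNorm_eq_sum,
    ← Equiv.sum_comp (Equiv.addRight (1 : Fin (n + 1)))]
  refine Finset.sum_congr rfl fun j _ => ?_
  rw [Equiv.coe_addRight, twistShift_add_one]
  congr 2
  exact propext (not_congr (mul_eq_zero_of_sq_eq_one (hτ j)))

theorem twistShift_vecMul (hτ : ∀ i, τ i * τ i = 1)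
    (hM : ∀ i j, M (i + 1) (j + 1) = τ i * τ j * M i j) (a : Fin (n + 1) → ZMod 3) :
    Matrix.vecMul (twistShift τ a) M = twistShift τ (Matrix.vecMul a M) := by
  funext j
  obtain ⟨j, rfl⟩ : ∃ i, j = i + 1 := ⟨j - 1, by simp⟩
  rw [twistShift_add_one]
  simp only [Matrix.vecMul, dotProduct]
  rw [← Equiv.sum_comp (Equiv.addRight (1 : Fin (n + 1))), Finset.mul_sum]
  refine Finset.sum_congr rfl fun i _ => ?_
  rw [Equiv.coe_addRight, twistShift_add_one, hM]
  linear_combination (a i * τ j * M i j) * hτ i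

theorem wordPenalty_twistShift (hτ : ∀ i, τ i * τ i = 1)
    (hM : ∀ i j, M (i + 1) (j + 1) = τ i * τ j * M i j) (d : ℕ) (a : Fin (n + 1) → ZMod 3) :
    wordPenalty d M (twistShift τ a) = wordPenalty d M a := by
  rw [wordPenalty, wordPenalty, twistShift_vecMul hτ hM, hammingNorm_twistShift hτ,
    hammingNorm_twistShift hτ]

theorem hammingNorm_neg {p : ℕ} (a : Fin p → ZMod 3) : hammingNorm (-a) = hammingNorm a := by
  simp [hammingNorm]

/-- The total contribution of the words of weight at most `K` with `a i ≠ 0`. -/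
def penaltyAt (d K : ℕ) (M : Matrix (Fin (n + 1)) (Fin (n + 1)) (ZMod 3)) (i : Fin (n + 1)) : ℕ :=
  ∑ a : Fin (n + 1) → ZMod 3, if hammingNorm a ≤ K then
    (if a i ≠ 0 then wordPenalty d M a else 0) else 0

/-- The signed shift permutes the words, keeps weights and penalties, and carries coordinate i to i
+ 1. -/
theorem penaltyAt_eq (hτ : ∀ i, τ i * τ i = 1)
    (hM : ∀ i j, M (i + 1) (j + 1) = τ i * τ j * M i j) (d K : ℕ) (i : Fin (n + 1)) :
    penaltyAt d K M i = penaltyAt d K M 0 := by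
  induction i using Fin.induction with
  | zero => rfl
  | succ i ih =>
    rw [← ih, ← Fin.coeSucc_eq_succ, penaltyAt, penaltyAt,
      ← Equiv.sum_comp (Equiv.ofBijective _ (twistShift_bijective hτ))]
    refine Finset.sum_congr rfl fun a _ => ?_
    rw [Equiv.ofBijective_apply, hammingNorm_twistShift hτ, wordPenalty_twistShift hτ hM,
      twistShift_add_one]
    simp only [ne_eq, mul_eq_zero_of_sq_eq_one (hτ _)]

/-- Negation exchanges the words with a 0 = 1 and a 0 = -1, hence the factor 2. Fixing a 0 = 1
starts the recursion at row 0 with K further rows allowed. -/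
theorem penaltyAt_zero {d K : ℕ} (hK : K + 1 ≤ d) :
    penaltyAt d (K + 1) M 0 = 2 * wordSum d (K + 1) (List.ofFn fun i : Fin n => M.row i.succ) K (M.row 0) := by
  have h1 : (1 : ZMod 3) ≠ 0 := by decide
  have h2 : (-1 : ZMod 3) ≠ 0 := by decide
  have key : ∑ a : Fin n → ZMod 3, (if hammingNorm (Fin.cons 1 a : Fin (n + 1) → ZMod 3) ≤ K + 1
      then wordPenalty d M (Fin.cons 1 a) else 0) =
      wordSum d (K + 1) (List.ofFn fun i : Fin n => M.row i.succ) K (M.row 0) := by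
    rw [wordSum_eq_sum]
    refine Finset.sum_congr rfl fun a _ => ?_
    have hv := cons_vecMul_ofFn 1 a M.row
    rw [one_smul] at hv
    rw [wordPenalty, ← hv, hammingNorm_cons, if_neg h1]
    change _ = if _ then penalty _ (_ - hammingNorm (Matrix.vecMul (Fin.cons 1 a) M)) else 0
    by_cases h : hammingNorm a ≤ K
    · rw [if_pos h, if_pos (by omega)]
      congr 2 <;> omega
    · rw [if_neg h, if_neg (by omega)]
  have hneg : ∀ a : Fin n → ZMod 3, (Fin.cons (-1) (-a) : Fin (n + 1) → ZMod 3) =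
      -(Fin.cons 1 a : Fin (n + 1) → ZMod 3) := fun a => by
    funext j
    refine Fin.cases ?_ (fun j => ?_) j <;> simp
  rw [penaltyAt, sum_cons, two_mul]
  simp only [Fin.cons_zero, ne_eq, not_true, if_false, h1, h2, not_false_iff, if_true, ite_self,
    Finset.sum_const_zero, zero_add]
  congr 1
  rw [← Equiv.sum_comp (Equiv.neg (Fin n → ZMod 3)), ← key]
  refine Finset.sum_congr rfl fun a _ => ?_
  rw [Equiv.neg_apply, hneg, wordPenalty, hammingNorm_neg, Matrix.neg_vecMul, hammingNorm_neg]
  rfl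

/-- Double counting of the pairs (a, i) with a i ≠ 0. -/
theorem sum_hammingNorm_mul (hτ : ∀ i, τ i * τ i = 1)
    (hM : ∀ i j, M (i + 1) (j + 1) = τ i * τ j * M i j) (d K : ℕ) :
    ∑ a : Fin (n + 1) → ZMod 3,
      (if hammingNorm a ≤ K then hammingNorm a * wordPenalty d M a else 0) =
      (n + 1) * penaltyAt d K M 0 := by
  calc _ = ∑ a : Fin (n + 1) → ZMod 3, ∑ i, if hammingNorm a ≤ K then
          (if a i ≠ 0 then wordPenalty d M a else 0) else 0 := by
        refine Finset.sum_congr rfl fun a _ => ?_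
        split_ifs with h
        · rw [← Finset.sum_filter, Finset.sum_const, smul_eq_mul]
          rfl
        · simp
    _ = ∑ i : Fin (n + 1), penaltyAt d K M i := Finset.sum_comm
    _ = _ := by simp [penaltyAt_eq hτ hM]

theorem lightBound_of_symm (hτ : ∀ i, τ i * τ i = 1)
    (hM : ∀ i j, M (i + 1) (j + 1) = τ i * τ j * M i j) {d K : ℕ} (hK : K + 1 ≤ d)
    (hK6 : K + 1 ≤ 6) {N : ℕ} (hN : N + 1 ≤ 1000000)
    (h : 2 * (n + 1) * wordSum d (K + 1) (List.ofFn fun i : Fin n => M.row i.succ) K (M.row 0) <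
      60 * (N + 1)) : LightBound d (K + 1) M N := by
  refine lightBound_of_sum_lt M hammingNorm (e := 60) (fun a ha haK => ?_) ?_ hN
  · have h0 := hammingNorm_pos_iff.2 ha
    have h6 := haK.trans hK6
    generalize hammingNorm a = w at *
    -- 60 is divisible by every w from 1 to 6, so w * (60 / w) = 60: the overcounting by position is
    -- compensated exactly.
    interval_cases w <;> norm_num
  · rw [sum_hammingNorm_mul hτ hM, penaltyAt_zero hK]
    calc _ = 2 * (n + 1) * wordSum d (K + 1) (List.ofFn fun i : Fin n => M.row i.succ) K (M.row 0) := by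
          ring
      _ < _ := h

end Symmetric

/-- Moving one step down the diagonal changes the entry by a factor c for each index that wraps
around; two wraps cancel as c² = 1. -/
theorem twistMatrix_add_one {n : ℕ} {c : ZMod 3} (hc : c * c = 1) (r : Fin (n + 1) → ZMod 3)
    (i j : Fin (n + 1)) :
    TernaryCode.twistMatrix c r (i + 1) (j + 1) =
      (if i = Fin.last n then c else 1) * (if j = Fin.last n then c else 1) *
        TernaryCode.twistMatrix c r i j := by
  simp only [TernaryCode.twistMatrix, Matrix.of_apply, add_sub_add_right_eq_sub]
  by_cases hi : i = Fin.last n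
  · subst hi
    simp only [Fin.last_add_one, Fin.zero_le, if_true]
    by_cases hj : j = Fin.last n
    · subst hj; simp [hc]
    · have : ¬ Fin.last n ≤ j := fun h => hj (Fin.last_le_iff.1 h)
      simp only [hj, this, if_false, mul_one, ← mul_assoc, hc, one_mul]
  · have hi' : (i : ℕ) < n := by
      have := i.2; have : (i : ℕ) ≠ n := fun h => hi (Fin.ext h); omega
    have hi1 : ((i + 1 : Fin (n + 1)) : ℕ) = i + 1 := Fin.val_add_one_of_lt' (by omega)
    by_cases hj : j = Fin.last n
    · subst hj
      have h1 : ¬ i + 1 ≤ Fin.last n + 1 := by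
        rw [Fin.last_add_one, Fin.le_def, hi1]; simp
      rw [if_neg h1, if_neg hi, if_pos rfl, if_pos (Fin.le_last _), one_mul]
    · have hj' : (j : ℕ) < n := by
        have := j.2; have : (j : ℕ) ≠ n := fun h => hj (Fin.ext h); omega
      have hj1 : ((j + 1 : Fin (n + 1)) : ℕ) = j + 1 := Fin.val_add_one_of_lt' (by omega)
      have h1 : i + 1 ≤ j + 1 ↔ i ≤ j := by rw [Fin.le_def, Fin.le_def, hi1, hj1]; omega
      simp [hi, hj, h1]

/-! ### Weight distributions and their comparison. -/

namespace TernaryCode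

open Classical in
/-- The codewords as a finite set. -/
noncomputable def words {n : ℕ} (C : TernaryCode n) : Finset (Fin n → ZMod 3) :=
  Finset.univ.filter (· ∈ C)

theorem mem_words {n : ℕ} {C : TernaryCode n} {c : Fin n → ZMod 3} : c ∈ C.words ↔ c ∈ C := by
  simp [words]

theorem weightCount_eq_card {n : ℕ} (C : TernaryCode n) (i : ℕ) :
    C.weightCount i = (C.words.filter fun c => hammingNorm c = i).card := by
  rw [weightCount, ← Set.ncard_coe_finset]
  congr 1
  ext c
  simp [mem_words]

theorem HasMinWeight.pos {n d : ℕ} {C : TernaryCode n} (h : C.HasMinWeight d) : 0 < d := by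
  obtain ⟨c, -, hc, rfl⟩ := h.1
  exact hammingNorm_pos_iff.2 hc

theorem HasMinWeight.le {n d : ℕ} {C : TernaryCode n} (h : C.HasMinWeight d) : d ≤ n := by
  obtain ⟨c, -, -, rfl⟩ := h.1
  simpa using hammingNorm_le_card_fintype (x := c)

theorem weightCount_zero {n : ℕ} (C : TernaryCode n) : C.weightCount 0 = 1 := by
  rw [weightCount, Set.ncard_eq_one]
  refine ⟨0, ?_⟩
  ext c
  simp only [hammingNorm_eq_zero, Set.mem_ofPred_eq, Set.mem_singleton_iff]
  exact ⟨fun h => h.2, fun h => ⟨h ▸ C.zero_mem, h⟩⟩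

theorem HasMinWeight.weightCount_eq_zero {n d : ℕ} {C : TernaryCode n} (h : C.HasMinWeight d)
    {i : ℕ} (h0 : 0 < i) (hi : i < d) : C.weightCount i = 0 := by
  rw [weightCount_eq_card, Finset.card_eq_zero, Finset.filter_eq_empty_iff]
  intro c hc hci
  have hne : c ≠ 0 := fun h => by rw [h, hammingNorm_zero] at hci; omega
  exact absurd (h.2 ⟨c, mem_words.1 hc, hne, hci⟩) (not_le.2 hi)

/-- Both distributions begin 1, 0, …, 0 below d. -/
theorem performsBetter_of_lt {n d : ℕ} {C C' : TernaryCode n} (h : C.HasMinWeight d)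
    (h' : C'.HasMinWeight d) (hlt : C.weightCount d < C'.weightCount d) : C.PerformsBetter C' := by
  refine ⟨d, h.le, fun i hi => ?_, hlt⟩
  rcases Nat.eq_zero_or_pos i with rfl | h0
  · rw [weightCount_zero, weightCount_zero]
  · rw [h.weightCount_eq_zero h0 hi, h'.weightCount_eq_zero h0 hi]

theorem not_performsBetter_self {n : ℕ} (C : TernaryCode n) : ¬ C.PerformsBetter C :=
  fun ⟨_, _, _, h⟩ => lt_irrefl _ h

/-! ### The number of minimum weight words of a self-dual code. -/

section SelfDual

variable {n : ℕ} {C : TernaryCode n}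

/-- Non-zero elements of F_3 have square 1, so c · c is the weight mod 3. -/
theorem IsSelfDual.three_dvd (h : C.IsSelfDual) {c : Fin n → ZMod 3} (hc : c ∈ C) :
    3 ∣ hammingNorm c := by
  have h0 : c ⬝ᵥ c = 0 := by
    have hc' := hc
    rw [h] at hc'
    exact hc' c hc
  rw [← ZMod.natCast_eq_zero_iff, ← h0, hammingNorm_eq_sum, dotProduct, Nat.cast_sum]
  refine Finset.sum_congr rfl fun j _ => ?_
  generalize c j = x; revert x; decide

/-- The restriction of the codewords to a set of coordinates. -/
def restrict (C : TernaryCode n) (J : Finset (Fin n)) : C →ₗ[ZMod 3] (J → ZMod 3) :=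
  (LinearMap.funLeft (ZMod 3) (ZMod 3) (Subtype.val : J → Fin n)).comp C.subtype

theorem IsSelfDual.range_restrict {d : ℕ} (h : C.IsSelfDual) (hd : C.HasMinWeight d)
    {J : Finset (Fin n)} (hJ : J.card < d) : LinearMap.range (C.restrict J) = ⊤ := by
  by_contra hne
  obtain ⟨f, hf, hker⟩ := Submodule.exists_le_ker_of_lt_top _ (lt_top_iff_ne_top.2 hne)
  -- The coefficients of a functional that kills the restricted code, extended by zero, form a word
  -- of the dual, hence of C, of weight at most |J| < d.
  let y : Fin n → ZMod 3 := fun i => if hi : i ∈ J then f (Pi.single ⟨i, hi⟩ 1) else 0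
  have hyJ (j : J) : y j = f (Pi.single j 1) := by simp [y]
  have hy : y ∈ C := by
    rw [h]
    intro c hc
    have h1 : f (C.restrict J ⟨c, hc⟩) = 0 := hker (LinearMap.mem_range_self _ _)
    rw [LinearMap.pi_apply_eq_sum_univ f] at h1
    rw [← h1, dotProduct, ← Finset.sum_subset (Finset.subset_univ J)
      fun i _ hi => by simp [y, hi], ← Finset.sum_coe_sort]
    refine Finset.sum_congr rfl fun j _ => ?_
    rw [hyJ, smul_eq_mul, mul_comm]
    change c j * _ = c j * _
    congr 2
    funext i
    simp [Pi.single_apply, eq_comm]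
  have hy0 : y ≠ 0 := by
    rintro h0
    refine hf (LinearMap.pi_ext' fun j => LinearMap.ext_ring ?_)
    simpa [h0] using (hyJ j).symm
  have hle : hammingNorm y ≤ J.card := by
    refine Finset.card_le_card fun i hi => ?_
    by_contra hiJ
    simp [y, hiJ] at hi
  exact absurd (hd.2 ⟨y, hy, hy0, rfl⟩) (by omega)

theorem IsSelfDual.card_vanishing {k d : ℕ} (h : C.IsSelfDual) (hp : C.HasParams k d)
    {J : Finset (Fin n)} (hJ : J.card < d) :
    (C.words.filter fun c => ∀ j ∈ J, c j = 0).card = 3 ^ (k - J.card) := by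
  have h1 := LinearMap.finrank_range_add_finrank_ker (C.restrict J)
  rw [h.range_restrict hp.2 hJ, finrank_top, hp.1, Module.finrank_pi, Fintype.card_coe] at h1
  have h2 : Nat.card (LinearMap.ker (C.restrict J)) = 3 ^ (k - J.card) := by
    rw [Module.natCard_eq_pow_finrank (K := ZMod 3), Nat.card_zmod]
    congr 1
    omega
  rw [← h2, ← Nat.card_eq_finsetCard]
  refine Nat.card_congr
    { toFun := fun c => ⟨⟨c, mem_words.1 (Finset.mem_filter.1 c.2).1⟩,
        funext fun j => (Finset.mem_filter.1 c.2).2 j j.2⟩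
      invFun := fun c => ⟨c, Finset.mem_filter.2 ⟨mem_words.2 c.1.2, fun j hj =>
        congrFun (LinearMap.mem_ker.1 c.2) ⟨j, hj⟩⟩⟩
      left_inv := fun _ => rfl
      right_inv := fun _ => rfl }

/-- Double counting of pairs of a word and a j-set of coordinates on which it vanishes. -/
theorem IsSelfDual.sum_choose {k d : ℕ} (h : C.IsSelfDual) (hp : C.HasParams k d) {j : ℕ}
    (hj : j < d) :
    ∑ c ∈ C.words, (n - hammingNorm c).choose j = n.choose j * 3 ^ (k - j) := by
  have h1 : ∀ c : Fin n → ZMod 3, (n - hammingNorm c).choose j =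
      ∑ J ∈ Finset.powersetCard j Finset.univ, if ∀ i ∈ J, c i = 0 then 1 else 0 := by
    intro c
    have hz : (Finset.univ.filter fun i => c i = 0).card = n - hammingNorm c := by
      have := Finset.card_filter_add_card_filter_not (s := Finset.univ) (fun i => c i = 0)
      rw [Finset.card_univ, Fintype.card_fin] at this
      simp only [hammingNorm, ne_eq]
      omega
    rw [← hz, ← Finset.card_powersetCard, ← Finset.card_filter]
    congr 1
    ext J
    simp [Finset.mem_powersetCard, Finset.subset_iff, and_comm]
  simp only [h1]
  rw [Finset.sum_comm]
  have h2 : ∀ J ∈ Finset.powersetCard j (Finset.univ : Finset (Fin n)),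
      (∑ c ∈ C.words, if ∀ i ∈ J, c i = 0 then 1 else 0) = 3 ^ (k - j) := by
    intro J hJ
    have hJ' := (Finset.mem_powersetCard.1 hJ).2
    rw [← Finset.card_filter, ← hJ']
    exact h.card_vanishing hp (hJ' ▸ hj)
  rw [Finset.sum_congr rfl h2, Finset.sum_const, Finset.card_powersetCard, Finset.card_univ,
    Fintype.card_fin, smul_eq_mul]

/-- The combination `∑ j, l[j] * (z choose j)`. -/
def newton (l : List ℤ) (z : ℕ) : ℤ :=
  ∑ j ∈ Finset.range l.length, l.getD j 0 * (z.choose j : ℤ)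

/-- A combination of binomial coefficients that vanishes at the weights divisible by `3` above
`d` determines the number of words of weight `d`. -/
theorem IsSelfDual.weightCount_mul {k d : ℕ} (h : C.IsSelfDual) (hp : C.HasParams k d)
    (l : List ℤ) (hl : l.length ≤ d)
    (hz : ∀ w ∈ Finset.range (n + 1), 3 ∣ w → d < w → newton l (n - w) = 0) :
    C.weightCount d * newton l (n - d) =
      ∑ j ∈ Finset.range l.length, l.getD j 0 * (n.choose j * 3 ^ (k - j) : ℕ) - newton l n := by
  have h1 : ∑ c ∈ C.words, newton l (n - hammingNorm c) =
      ∑ j ∈ Finset.range l.length, l.getD j 0 * (n.choose j * 3 ^ (k - j) : ℕ) := by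
    simp only [newton]
    rw [Finset.sum_comm]
    refine Finset.sum_congr rfl fun j hj => ?_
    rw [← Finset.mul_sum, ← h.sum_choose hp ((Finset.mem_range.1 hj).trans_le hl), Nat.cast_sum]
  have h2 : ∀ c ∈ C.words, newton l (n - hammingNorm c) =
      (if hammingNorm c = 0 then newton l n else 0) +
        if hammingNorm c = d then newton l (n - d) else 0 := by
    intro c hc
    have hc' := mem_words.1 hc
    have hd := hp.2.pos
    by_cases h0 : hammingNorm c = 0
    · rw [if_pos h0, if_neg (by omega), h0, add_zero, Nat.sub_zero]
    · rw [if_neg h0, zero_add]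
      split_ifs with hcd
      · rw [hcd]
      · have hle : d ≤ hammingNorm c := hp.2.2 ⟨c, hc', fun h => h0 (by simp [h]), rfl⟩
        have hn : hammingNorm c ≤ n := by simpa using hammingNorm_le_card_fintype (x := c)
        exact hz _ (Finset.mem_range.2 (by omega)) (h.three_dvd hc') (by omega)
  rw [← h1, Finset.sum_congr rfl h2, Finset.sum_add_distrib, ← Finset.sum_filter,
    ← Finset.sum_filter, Finset.sum_const, Finset.sum_const, ← weightCount_eq_card,
    ← weightCount_eq_card, weightCount_zero]
  simp

end SelfDual

/-! ### Systematic codes with an invertible right half. -/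

/-- The code with generator matrix `(I  M)`. -/
def systematic {n m : ℕ} (h : n = m + m) (M : Matrix (Fin m) (Fin m) (ZMod 3)) : TernaryCode n :=
  (LinearMap.range (Matrix.fromCols (1 : Matrix (Fin m) (Fin m) (ZMod 3)) M).vecMulLinear).map
    (LinearMap.funLeft (ZMod 3) (ZMod 3) fun j : Fin n => finSumFinEquiv.symm (Fin.cast h j))

section Systematic

variable {n m : ℕ} (h : n = m + m) (M : Matrix (Fin m) (Fin m) (ZMod 3))

theorem systematic_isGeneratedBy : (systematic h M).IsGeneratedBy h M := by
  rw [IsGeneratedBy, systematic, range_vecMulLinear, Submodule.map_span, ← Set.range_comp]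
  rfl

/-- The codeword `(a, a M)`. -/
def codeword (a : Fin m → ZMod 3) : Fin n → ZMod 3 :=
  fun j => Sum.elim a (Matrix.vecMul a M) (finSumFinEquiv.symm (Fin.cast h j))

theorem mem_systematic {c : Fin n → ZMod 3} : c ∈ systematic h M ↔ ∃ a, codeword h M a = c := by
  have key (a : Fin m → ZMod 3) : (LinearMap.funLeft (ZMod 3) (ZMod 3)
      fun j : Fin n => finSumFinEquiv.symm (Fin.cast h j))
      ((Matrix.fromCols (1 : Matrix (Fin m) (Fin m) (ZMod 3)) M).vecMulLinear a) =
      codeword h M a := by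
    funext j
    rw [LinearMap.funLeft_apply, Matrix.vecMulLinear_apply, Matrix.vecMul_fromCols,
      Matrix.vecMul_one]
    rfl
  simp only [systematic, Submodule.mem_map, LinearMap.mem_range, exists_exists_eq_and, key]

theorem hammingNorm_codeword (a : Fin m → ZMod 3) :
    hammingNorm (codeword h M a) = hammingNorm a + hammingNorm (Matrix.vecMul a M) := by
  subst h
  rw [hammingNorm_eq_sum, hammingNorm_eq_sum, hammingNorm_eq_sum,
    ← Equiv.sum_comp finSumFinEquiv, Fintype.sum_sum_type]
  simp only [codeword, Fin.cast_refl, id, Equiv.symm_apply_apply, Sum.elim_inl, Sum.elim_inr]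

theorem codeword_injective : Function.Injective (codeword h M) := by
  subst h
  intro a b hab
  funext i
  simpa [codeword] using congrFun hab (finSumFinEquiv (Sum.inl i))

theorem finrank_systematic : Module.finrank (ZMod 3) (systematic h M) = m := by
  have hc : Nat.card (systematic h M) = 3 ^ m := by
    rw [← Nat.card_congr (Equiv.ofBijective (fun a : Fin m → ZMod 3 =>
      (⟨codeword h M a, (mem_systematic h M).2 ⟨a, rfl⟩⟩ : systematic h M))
      ⟨fun a b hab => codeword_injective h M (congrArg Subtype.val hab), fun ⟨c, hc⟩ => by
        obtain ⟨a, rfl⟩ := (mem_systematic h M).1 hc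
        exact ⟨a, rfl⟩⟩)]
    simp
  rw [Module.natCard_eq_pow_finrank (K := ZMod 3), Nat.card_zmod] at hc
  exact Nat.pow_right_injective le_rfl (by simpa using hc)

variable {M} {M' : Matrix (Fin m) (Fin m) (ZMod 3)} {d K K' N N' : ℕ}

/-- If the total weight is below d and a has weight above K, then b = aM has weight at most K', and
(b, bM') is the same word with its halves exchanged. -/
theorem le_hammingNorm_codeword (hM : M * M' = 1) (hL : LightBound d K M N)
    (hR : LightBound d K' M' N') (hK : d ≤ K + K' + 1) {a : Fin m → ZMod 3} (ha : a ≠ 0) :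
    d ≤ hammingNorm a + hammingNorm (Matrix.vecMul a M) := by
  by_contra! hlt
  rcases le_or_gt (hammingNorm a) K with haK | haK
  · exact absurd (hL.1 a ha haK) (by omega)
  · have hinv : Matrix.vecMul (Matrix.vecMul a M) M' = a := by
      rw [Matrix.vecMul_vecMul, hM, Matrix.vecMul_one]
    have h0 : Matrix.vecMul a M ≠ 0 := fun h0 => ha (by rw [← hinv, h0, Matrix.zero_vecMul])
    have := hR.1 _ h0 (by omega)
    rw [hinv] at this
    omega

theorem weightCount_systematic_le (hM : M * M' = 1) (hL : LightBound d K M N)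
    (hR : LightBound d K' M' N') (hK : d ≤ K + K' + 1) (hd : 0 < d) :
    (systematic h M).weightCount d ≤ N + N' := by
  set S := Finset.univ.filter fun a : Fin m → ZMod 3 => a ≠ 0 ∧ hammingNorm a ≤ K ∧
    hammingNorm a + hammingNorm (Matrix.vecMul a M) = d with hS
  set T := Finset.univ.filter fun b : Fin m → ZMod 3 => b ≠ 0 ∧ hammingNorm b ≤ K' ∧
    hammingNorm b + hammingNorm (Matrix.vecMul b M') = d with hT
  have hsub : ((systematic h M).words.filter fun c => hammingNorm c = d) ⊆
      S.image (codeword h M) ∪ T.image fun b => codeword h M (Matrix.vecMul b M') := by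
    intro c hc
    obtain ⟨hcC, hcd⟩ := Finset.mem_filter.1 hc
    obtain ⟨a, rfl⟩ := (mem_systematic h M).1 (mem_words.1 hcC)
    rw [hammingNorm_codeword] at hcd
    have ha : a ≠ 0 := by
      rintro rfl
      rw [Matrix.zero_vecMul, hammingNorm_zero] at hcd
      omega
    have hinv : Matrix.vecMul (Matrix.vecMul a M) M' = a := by
      rw [Matrix.vecMul_vecMul, hM, Matrix.vecMul_one]
    rcases le_or_gt (hammingNorm a) K with haK | haK
    · exact Finset.mem_union_left _ (Finset.mem_image_of_mem _ (by simp [hS, ha, haK, hcd]))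
    · refine Finset.mem_union_right _ (Finset.mem_image.2 ⟨Matrix.vecMul a M, ?_, by rw [hinv]⟩)
      have h0 : Matrix.vecMul a M ≠ 0 := fun h0 => ha (by rw [← hinv, h0, Matrix.zero_vecMul])
      simp only [hT, Finset.mem_filter, Finset.mem_univ, true_and, hinv]
      exact ⟨h0, by omega, by omega⟩
  rw [weightCount_eq_card]
  calc _ ≤ _ := Finset.card_le_card hsub
    _ ≤ (S.image (codeword h M)).card + _ := Finset.card_union_le _ _
    _ ≤ S.card + T.card := Nat.add_le_add Finset.card_image_le Finset.card_image_le
    _ ≤ N + N' := Nat.add_le_add hL.2 hR.2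

/-- A systematic code with few words of minimum weight performs better than every self-dual code. -/
theorem systematic_performsBetter {V : ℕ} (hM : M * M' = 1) (hL : LightBound d K M N)
    (hR : LightBound d K' M' N') (hK : d ≤ K + K' + 1) (hd : 0 < d)
    (hw : ∃ a : Fin m → ZMod 3, hammingNorm a + hammingNorm (Matrix.vecMul a M) = d)
    (hV : ∀ C' : TernaryCode n, C'.IsSelfDual → C'.HasParams (n / 2) d → C'.weightCount d = V)
    (hNV : N + N' < V) :
    (systematic h M).HasParams (n / 2) d ∧ ¬ (systematic h M).IsSelfDual ∧
      ∀ C' : TernaryCode n, C'.IsSelfDual → C'.HasParams (n / 2) d →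
        (systematic h M).PerformsBetter C' := by
  have hmin : (systematic h M).HasMinWeight d := by
    constructor
    · obtain ⟨a, ha⟩ := hw
      rw [← hammingNorm_codeword h] at ha
      refine ⟨codeword h M a, (mem_systematic h M).2 ⟨a, rfl⟩, fun h0 => ?_, ha⟩
      rw [h0, hammingNorm_zero] at ha
      omega
    · rintro w ⟨c, hc, hc0, rfl⟩
      obtain ⟨a, rfl⟩ := (mem_systematic h M).1 hc
      rw [hammingNorm_codeword]
      refine le_hammingNorm_codeword hM hL hR hK ?_
      rintro rfl
      refine hc0 (funext fun j => ?_)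
      rw [codeword, Matrix.zero_vecMul]
      cases finSumFinEquiv.symm (Fin.cast h j) <;> rfl
  have hpar : (systematic h M).HasParams (n / 2) d :=
    ⟨by rw [finrank_systematic]; omega, hmin⟩
  have hbetter : ∀ C' : TernaryCode n, C'.IsSelfDual → C'.HasParams (n / 2) d →
      (systematic h M).PerformsBetter C' := fun C' hC' hp =>
    performsBetter_of_lt hmin hp.2 <| by
      rw [hV C' hC' hp]
      exact (weightCount_systematic_le h hM hL hR hK hd).trans_lt hNV
  -- If the code were self-dual, it would perform better than itself.
  exact ⟨hpar, fun hs => not_performsBetter_self _ (hbetter _ hs hpar), hbetter⟩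

end Systematic

end TernaryCode

/-! ### Numerical criteria for the examples. -/

/-- A bound for the words with `a` of weight at most `k + 1`, by search. -/
theorem lightBound_of_search {m : ℕ} (hm : 0 < m) (hm' : m ≤ 42) {d k : ℕ} (hk : k < d)
    (hd : d ≤ m + k) (M : Matrix (Fin m) (Fin m) (ZMod 3)) {N : ℕ} (hN : N + 1 ≤ 1000000)
    (h : search d (k + 1) (List.ofFn M.row ++ (List.ofFn M.row).map Neg.neg) k
      ((List.ofFn M.row).map encode) (plane 1 (0 : Fin m → ZMod 3))
      (plane 2 (0 : Fin m → ZMod 3)) < 60 / (k + 1) * (N + 1)) :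
    LightBound d (k + 1) M N := by
  rw [search_eq hm (by omega) hk (by omega) _ _ _ (List.Subset.refl _)] at h
  exact lightBound_of_wordSum_lt hk M hN h

/-- A bound for the words of weight at most `k + 2` of a circulant or negacirculant code, by a
search through those with `a 0 = 1`. -/
theorem lightBound_of_search_twist {n : ℕ} (hn : n < 42) {d k : ℕ} (hk : k + 2 ≤ d)
    (hk6 : k + 2 ≤ 6) (hd : d ≤ n + k + 2) {c : ZMod 3} (hc : c * c = 1)
    (r : Fin (n + 1) → ZMod 3) {N : ℕ} (hN : N + 1 ≤ 1000000)
    (h : 2 * (n + 1) * search d (k + 2)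
      ((List.ofFn fun i : Fin n => (TernaryCode.twistMatrix c r).row i.succ) ++
        (List.ofFn fun i : Fin n => (TernaryCode.twistMatrix c r).row i.succ).map Neg.neg) k
      ((List.ofFn fun i : Fin n => (TernaryCode.twistMatrix c r).row i.succ).map encode)
      (plane 1 ((TernaryCode.twistMatrix c r).row 0))
      (plane 2 ((TernaryCode.twistMatrix c r).row 0)) < 60 * (N + 1)) :
    LightBound d (k + 2) (TernaryCode.twistMatrix c r) N := by
  rw [search_eq (Nat.succ_pos n) (by omega) hk (by omega) _ _ _ (List.Subset.refl _)] at h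
  refine lightBound_of_symm (τ := fun i => if i = Fin.last n then c else 1) (fun i => ?_)
    (fun i j => twistMatrix_add_one hc r i j) hk hk6 hN h
  split_ifs
  · exact hc
  · rfl

namespace TernaryCode

theorem IsSelfDual.weightCount_eq {n k d V : ℕ} {C : TernaryCode n} (h : C.IsSelfDual)
    (hp : C.HasParams k d) (l : List ℤ) (hl : l.length ≤ d)
    (hz : ∀ w ∈ Finset.range (n + 1), 3 ∣ w → d < w → newton l (n - w) = 0)
    (hne : newton l (n - d) ≠ 0)
    (hV : ∑ j ∈ Finset.range l.length, l.getD j 0 * (n.choose j * 3 ^ (k - j) : ℕ) - newton l n =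
      V * newton l (n - d)) : C.weightCount d = V := by
  have := h.weightCount_mul hp l hl hz
  rw [hV] at this
  exact_mod_cast mul_right_cancel₀ hne this

variable {n m d K K' N N' V : ℕ}

theorem exists_pureDoubleCirculant (h : n = m + m) (r s : Fin m → ZMod 3)
    (hM : twistMatrix 1 r * twistMatrix 1 s = 1)
    (hL : LightBound d K (twistMatrix 1 r) N) (hR : LightBound d K' (twistMatrix 1 s) N')
    (hK : d ≤ K + K' + 1) (hd : 0 < d)
    (hw : ∃ a : Fin m → ZMod 3,
      hammingNorm a + hammingNorm (Matrix.vecMul a (twistMatrix 1 r)) = d)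
    (hV : ∀ C' : TernaryCode n, C'.IsSelfDual → C'.HasParams (n / 2) d → C'.weightCount d = V)
    (hNV : N + N' < V) :
    ∃ C : TernaryCode n, C.IsDoubleCirculant ∧ C.HasParams (n / 2) d ∧ ¬ C.IsSelfDual ∧
      ∀ C' : TernaryCode n, C'.IsSelfDual → C'.HasParams (n / 2) d → C.PerformsBetter C' :=
  ⟨systematic h _, Or.inl ⟨m, h, _, ⟨r, rfl⟩, systematic_isGeneratedBy h _⟩,
    systematic_performsBetter h hM hL hR hK hd hw hV hNV⟩

theorem exists_doubleTwistulant (h : n = m + m) (r s : Fin m → ZMod 3)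
    (hM : twistMatrix (-1) r * twistMatrix (-1) s = 1)
    (hL : LightBound d K (twistMatrix (-1) r) N) (hR : LightBound d K' (twistMatrix (-1) s) N')
    (hK : d ≤ K + K' + 1) (hd : 0 < d)
    (hw : ∃ a : Fin m → ZMod 3,
      hammingNorm a + hammingNorm (Matrix.vecMul a (twistMatrix (-1) r)) = d)
    (hV : ∀ C' : TernaryCode n, C'.IsSelfDual → C'.HasParams (n / 2) d → C'.weightCount d = V)
    (hNV : N + N' < V) :
    ∃ C : TernaryCode n, C.IsDoubleTwistulant ∧ C.HasParams (n / 2) d ∧ ¬ C.IsSelfDual ∧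
      ∀ C' : TernaryCode n, C'.IsSelfDual → C'.HasParams (n / 2) d → C.PerformsBetter C' :=
  ⟨systematic h _, ⟨m, h, _, ⟨r, rfl⟩, systematic_isGeneratedBy h _⟩,
    systematic_performsBetter h hM hL hR hK hd hw hV hNV⟩

theorem exists_borderedDoubleCirculant {k : ℕ} (h : n = (k + 1) + (k + 1))
    (α β γ α' β' γ' : ZMod 3) (r s : Fin k → ZMod 3)
    (hM : borderedMatrix α β γ (twistMatrix 1 r) * borderedMatrix α' β' γ' (twistMatrix 1 s) = 1)
    (hL : LightBound d K (borderedMatrix α β γ (twistMatrix 1 r)) N)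
    (hR : LightBound d K' (borderedMatrix α' β' γ' (twistMatrix 1 s)) N')
    (hK : d ≤ K + K' + 1) (hd : 0 < d)
    (hw : ∃ a : Fin (k + 1) → ZMod 3,
      hammingNorm a + hammingNorm (Matrix.vecMul a (borderedMatrix α β γ (twistMatrix 1 r))) = d)
    (hV : ∀ C' : TernaryCode n, C'.IsSelfDual → C'.HasParams (n / 2) d → C'.weightCount d = V)
    (hNV : N + N' < V) :
    ∃ C : TernaryCode n, C.IsDoubleCirculant ∧ C.HasParams (n / 2) d ∧ ¬ C.IsSelfDual ∧
      ∀ C' : TernaryCode n, C'.IsSelfDual → C'.HasParams (n / 2) d → C.PerformsBetter C' :=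
  ⟨systematic h _, Or.inr ⟨k, h, α, β, γ, _, ⟨r, rfl⟩, systematic_isGeneratedBy h _⟩,
    systematic_performsBetter h hM hL hR hK hd hw hV hNV⟩

end TernaryCode

/-! ### The values V and the explicit codes. -/

namespace TernaryCode

theorem weightCount_selfDual_eight (C : TernaryCode 8) (h : C.IsSelfDual)
    (hp : C.HasParams (8 / 2) 3) : C.weightCount 3 = 16 :=
  -- Here and below the list gives, in the basis of binomial coefficients, a multiple of the product
  -- of z - (n - w) over the multiples w of 3 with d < w ≤ n.
  h.weightCount_eq hp [-2, 1]
    (by decide) (by decide +kernel) (by decide +kernel) (by decide +kernel)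

theorem weightCount_selfDual_sixteen (C : TernaryCode 16) (h : C.IsSelfDual)
    (hp : C.HasParams (16 / 2) 6) : C.weightCount 6 = 224 :=
  h.weightCount_eq hp [-14, 14, -9, 3]
    (by decide) (by decide +kernel) (by decide +kernel) (by decide +kernel)

theorem weightCount_selfDual_twenty (C : TernaryCode 20) (h : C.IsSelfDual)
    (hp : C.HasParams (20 / 2) 6) : C.weightCount 6 = 120 :=
  h.weightCount_eq hp [110, -75, 40, -15, 3]
    (by decide) (by decide +kernel) (by decide +kernel) (by decide +kernel)

theorem weightCount_selfDual_twentyeight (C : TernaryCode 28) (h : C.IsSelfDual)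
    (hp : C.HasParams (28 / 2) 9) : C.weightCount 9 = 2184 :=
  h.weightCount_eq hp [728, -728, 574, -357, 168, -54, 9]
    (by decide) (by decide +kernel) (by decide +kernel) (by decide +kernel)

theorem weightCount_selfDual_thirtytwo (C : TernaryCode 32) (h : C.IsSelfDual)
    (hp : C.HasParams (32 / 2) 9) : C.weightCount 9 = 960 :=
  h.weightCount_eq hp [-7480, 5504, -3528, 1926, -864, 300, -72, 9]
    (by decide) (by decide +kernel) (by decide +kernel) (by decide +kernel)

theorem weightCount_selfDual_fortyfour (C : TernaryCode 44) (h : C.IsSelfDual)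
    (hp : C.HasParams (44 / 2) 12) : C.weightCount 12 = 8008 :=
  h.weightCount_eq hp [1621477, -1241097, 860717, -536250, 296439, -142857, 58509, -19602, 5049, -891, 81]
    (by decide) (by decide +kernel) (by decide +kernel) (by decide +kernel)

theorem exists_doubleCirculant_eight : ∃ C : TernaryCode 8, C.IsDoubleCirculant ∧
    C.HasParams (8 / 2) 3 ∧ ¬ C.IsSelfDual ∧
      ∀ C' : TernaryCode 8, C'.IsSelfDual → C'.HasParams (8 / 2) 3 → C.PerformsBetter C' :=
  exists_borderedDoubleCirculant (by decide) 1 1 2 1 2 1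
    -- In all examples the second set of data describes the inverse matrix, which is again of the
    -- same type.
    ![1, 0, 0] ![0, 2, 2]
    (by decide +kernel)
    (lightBound_of_search (k := 0) (N := 6) (by decide) (by decide) (by decide) (by decide) _
      (by decide) (by decide +kernel))
    (lightBound_of_search (k := 0) (N := 0) (by decide) (by decide) (by decide) (by decide) _
      (by decide) (by decide +kernel))
    (by decide) (by decide) ⟨![0, 1, 0, 0], by decide +kernel⟩
    weightCount_selfDual_eight (by decide)

theorem exists_doubleTwistulant_eight : ∃ C : TernaryCode 8, C.IsDoubleTwistulant ∧
    C.HasParams (8 / 2) 3 ∧ ¬ C.IsSelfDual ∧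
      ∀ C' : TernaryCode 8, C'.IsSelfDual → C'.HasParams (8 / 2) 3 → C.PerformsBetter C' :=
  exists_doubleTwistulant (by decide) ![0, 0, 1, 1] ![2, 1, 1, 2]
    (by decide +kernel)
    (lightBound_of_search (k := 0) (N := 8) (by decide) (by decide) (by decide) (by decide) _
      (by decide) (by decide +kernel))
    (lightBound_of_search (k := 0) (N := 0) (by decide) (by decide) (by decide) (by decide) _
      (by decide) (by decide +kernel))
    (by decide) (by decide) ⟨![1, 0, 0, 0], by decide +kernel⟩
    weightCount_selfDual_eight (by decide)

theorem exists_doubleCirculant_sixteen : ∃ C : TernaryCode 16, C.IsDoubleCirculant ∧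
    C.HasParams (16 / 2) 6 ∧ ¬ C.IsSelfDual ∧
      ∀ C' : TernaryCode 16, C'.IsSelfDual → C'.HasParams (16 / 2) 6 → C.PerformsBetter C' :=
  exists_pureDoubleCirculant (by decide) ![2, 1, 0, 2, 0, 0, 1, 2] ![2, 2, 1, 1, 0, 2, 0, 0]
    (by decide +kernel)
    (lightBound_of_search_twist (k := 1) (N := 64) (by decide) (by decide) (by decide) (by decide)
      (by decide) _ (by decide) (by decide +kernel))
    (lightBound_of_search_twist (k := 0) (N := 32) (by decide) (by decide) (by decide) (by decide)
      (by decide) _ (by decide) (by decide +kernel))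
    (by decide) (by decide) ⟨![1, 0, 0, 0, 0, 0, 0, 0], by decide +kernel⟩
    weightCount_selfDual_sixteen (by decide)

theorem exists_doubleTwistulant_sixteen : ∃ C : TernaryCode 16, C.IsDoubleTwistulant ∧
    C.HasParams (16 / 2) 6 ∧ ¬ C.IsSelfDual ∧
      ∀ C' : TernaryCode 16, C'.IsSelfDual → C'.HasParams (16 / 2) 6 → C.PerformsBetter C' :=
  exists_doubleTwistulant (by decide) ![1, 0, 2, 1, 1, 0, 0, 1] ![0, 2, 2, 0, 1, 1, 2, 0]
    (by decide +kernel)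
    (lightBound_of_search_twist (k := 1) (N := 48) (by decide) (by decide) (by decide) (by decide)
      (by decide) _ (by decide) (by decide +kernel))
    (lightBound_of_search_twist (k := 0) (N := 48) (by decide) (by decide) (by decide) (by decide)
      (by decide) _ (by decide) (by decide +kernel))
    (by decide) (by decide) ⟨![1, 0, 0, 0, 0, 0, 0, 0], by decide +kernel⟩
    weightCount_selfDual_sixteen (by decide)

theorem exists_doubleCirculant_twenty : ∃ C : TernaryCode 20, C.IsDoubleCirculant ∧
    C.HasParams (20 / 2) 6 ∧ ¬ C.IsSelfDual ∧
      ∀ C' : TernaryCode 20, C'.IsSelfDual → C'.HasParams (20 / 2) 6 → C.PerformsBetter C' :=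
  exists_pureDoubleCirculant (by decide) ![2, 2, 0, 1, 1, 2, 0, 0, 0, 0] ![0, 1, 2, 2, 0, 0, 0, 0, 1, 2]
    (by decide +kernel)
    (lightBound_of_search_twist (k := 1) (N := 20) (by decide) (by decide) (by decide) (by decide)
      (by decide) _ (by decide) (by decide +kernel))
    (lightBound_of_search_twist (k := 0) (N := 20) (by decide) (by decide) (by decide) (by decide)
      (by decide) _ (by decide) (by decide +kernel))
    (by decide) (by decide) ⟨![1, 0, 0, 0, 0, 0, 0, 0, 0, 0], by decide +kernel⟩
    weightCount_selfDual_twenty (by decide)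

theorem exists_doubleTwistulant_twenty : ∃ C : TernaryCode 20, C.IsDoubleTwistulant ∧
    C.HasParams (20 / 2) 6 ∧ ¬ C.IsSelfDual ∧
      ∀ C' : TernaryCode 20, C'.IsSelfDual → C'.HasParams (20 / 2) 6 → C.PerformsBetter C' :=
  exists_doubleTwistulant (by decide) ![0, 1, 0, 0, 2, 0, 2, 0, 1, 1] ![1, 1, 1, 1, 0, 2, 2, 2, 1, 2]
    (by decide +kernel)
    (lightBound_of_search_twist (k := 1) (N := 60) (by decide) (by decide) (by decide) (by decide)
      (by decide) _ (by decide) (by decide +kernel))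
    (lightBound_of_search_twist (k := 0) (N := 20) (by decide) (by decide) (by decide) (by decide)
      (by decide) _ (by decide) (by decide +kernel))
    (by decide) (by decide) ⟨![1, 0, 0, 0, 0, 0, 0, 0, 0, 0], by decide +kernel⟩
    weightCount_selfDual_twenty (by decide)

theorem exists_doubleCirculant_twentyeight : ∃ C : TernaryCode 28, C.IsDoubleCirculant ∧
    C.HasParams (28 / 2) 9 ∧ ¬ C.IsSelfDual ∧
      ∀ C' : TernaryCode 28, C'.IsSelfDual → C'.HasParams (28 / 2) 9 → C.PerformsBetter C' :=
  exists_borderedDoubleCirculant (by decide) 2 1 2 0 2 1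
    ![2, 0, 2, 2, 1, 2, 2, 1, 0, 2, 1, 2, 1] ![1, 2, 1, 2, 2, 1, 2, 2, 2, 0, 0, 1, 1]
    (by decide +kernel)
    (lightBound_of_search (k := 3) (N := 589) (by decide) (by decide) (by decide) (by decide) _
      (by decide) (by decide +kernel))
    (lightBound_of_search (k := 3) (N := 459) (by decide) (by decide) (by decide) (by decide) _
      (by decide) (by decide +kernel))
    -- The first two rows of the generator matrix have weights 15 and 13; their sum has weight 2 + 7
    -- = 9.
    (by decide) (by decide) ⟨![1, 1, 0, 0, 0, 0, 0, 0, 0, 0, 0, 0, 0, 0], by decide +kernel⟩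
    weightCount_selfDual_twentyeight (by decide)

theorem exists_doubleTwistulant_twentyeight : ∃ C : TernaryCode 28, C.IsDoubleTwistulant ∧
    C.HasParams (28 / 2) 9 ∧ ¬ C.IsSelfDual ∧
      ∀ C' : TernaryCode 28, C'.IsSelfDual → C'.HasParams (28 / 2) 9 → C.PerformsBetter C' :=
  exists_doubleTwistulant (by decide) ![1, 1, 0, 0, 0, 0, 1, 1, 2, 0, 2, 0, 2, 1] ![1, 2, 2, 0, 2, 0, 2, 2, 2, 1, 0, 0, 0, 0]
    (by decide +kernel)
    (lightBound_of_search_twist (k := 2) (N := 308) (by decide) (by decide) (by decide) (by decide)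
      (by decide) _ (by decide) (by decide +kernel))
    (lightBound_of_search_twist (k := 2) (N := 308) (by decide) (by decide) (by decide) (by decide)
      (by decide) _ (by decide) (by decide +kernel))
    (by decide) (by decide) ⟨![1, 0, 0, 0, 0, 0, 0, 0, 0, 0, 0, 0, 0, 0], by decide +kernel⟩
    weightCount_selfDual_twentyeight (by decide)

theorem exists_doubleCirculant_thirtytwo : ∃ C : TernaryCode 32, C.IsDoubleCirculant ∧
    C.HasParams (32 / 2) 9 ∧ ¬ C.IsSelfDual ∧
      ∀ C' : TernaryCode 32, C'.IsSelfDual → C'.HasParams (32 / 2) 9 → C.PerformsBetter C' :=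
  exists_pureDoubleCirculant (by decide) ![1, 2, 0, 1, 2, 2, 0, 0, 0, 2, 0, 0, 1, 0, 2, 0] ![1, 2, 2, 1, 1, 0, 2, 1, 0, 0, 2, 1, 0, 1, 1, 1]
    (by decide +kernel)
    (lightBound_of_search_twist (k := 2) (N := 160) (by decide) (by decide) (by decide) (by decide)
      (by decide) _ (by decide) (by decide +kernel))
    (lightBound_of_search_twist (k := 2) (N := 96) (by decide) (by decide) (by decide) (by decide)
      (by decide) _ (by decide) (by decide +kernel))
    (by decide) (by decide) ⟨![1, 0, 0, 0, 0, 0, 0, 0, 0, 0, 0, 0, 0, 0, 0, 0], by decide +kernel⟩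
    weightCount_selfDual_thirtytwo (by decide)

theorem exists_doubleTwistulant_thirtytwo : ∃ C : TernaryCode 32, C.IsDoubleTwistulant ∧
    C.HasParams (32 / 2) 9 ∧ ¬ C.IsSelfDual ∧
      ∀ C' : TernaryCode 32, C'.IsSelfDual → C'.HasParams (32 / 2) 9 → C.PerformsBetter C' :=
  exists_doubleTwistulant (by decide) ![0, 0, 2, 1, 2, 0, 2, 1, 1, 2, 0, 0, 2, 0, 0, 0] ![0, 0, 0, 0, 1, 2, 2, 2, 1, 0, 0, 1, 2, 2, 2, 2]
    (by decide +kernel)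
    (lightBound_of_search_twist (k := 2) (N := 160) (by decide) (by decide) (by decide) (by decide)
      (by decide) _ (by decide) (by decide +kernel))
    (lightBound_of_search_twist (k := 2) (N := 96) (by decide) (by decide) (by decide) (by decide)
      (by decide) _ (by decide) (by decide +kernel))
    (by decide) (by decide) ⟨![1, 0, 0, 0, 0, 0, 0, 0, 0, 0, 0, 0, 0, 0, 0, 0], by decide +kernel⟩
    weightCount_selfDual_thirtytwo (by decide)

theorem exists_doubleCirculant_fortyfour : ∃ C : TernaryCode 44, C.IsDoubleCirculant ∧
    C.HasParams (44 / 2) 12 ∧ ¬ C.IsSelfDual ∧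
      ∀ C' : TernaryCode 44, C'.IsSelfDual → C'.HasParams (44 / 2) 12 → C.PerformsBetter C' :=
  exists_pureDoubleCirculant (by decide) ![1, 2, 0, 0, 1, 1, 0, 2, 2, 0, 0, 2, 0, 0, 0, 2, 0, 2, 0, 0, 2, 2] ![0, 2, 0, 2, 0, 1, 1, 0, 1, 1, 2, 2, 2, 1, 1, 2, 0, 1, 2, 1, 0, 0]
    (by decide +kernel)
    (lightBound_of_search_twist (k := 4) (N := 1386) (by decide) (by decide) (by decide) (by decide)
      (by decide) _ (by decide) (by decide +kernel))
    (lightBound_of_search_twist (k := 3) (N := 1012) (by decide) (by decide) (by decide) (by decide)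
      (by decide) _ (by decide) (by decide +kernel))
    (by decide) (by decide) ⟨![1, 0, 0, 0, 0, 0, 0, 0, 0, 0, 0, 0, 0, 0, 0, 0, 0, 0, 0, 0, 0, 0], by decide +kernel⟩
    weightCount_selfDual_fortyfour (by decide)

theorem exists_doubleTwistulant_fortyfour : ∃ C : TernaryCode 44, C.IsDoubleTwistulant ∧
    C.HasParams (44 / 2) 12 ∧ ¬ C.IsSelfDual ∧
      ∀ C' : TernaryCode 44, C'.IsSelfDual → C'.HasParams (44 / 2) 12 → C.PerformsBetter C' :=
  exists_doubleTwistulant (by decide) ![1, 2, 0, 0, 1, 2, 2, 2, 0, 0, 0, 0, 2, 0, 0, 1, 0, 1, 1, 0, 0, 1] ![2, 1, 1, 0, 2, 1, 1, 1, 1, 1, 1, 1, 1, 0, 2, 1, 0, 0, 0, 2, 0, 2]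
    (by decide +kernel)
    (lightBound_of_search_twist (k := 4) (N := 1364) (by decide) (by decide) (by decide) (by decide)
      (by decide) _ (by decide) (by decide +kernel))
    (lightBound_of_search_twist (k := 3) (N := 1144) (by decide) (by decide) (by decide) (by decide)
      (by decide) _ (by decide) (by decide +kernel))
    (by decide) (by decide) ⟨![1, 0, 0, 0, 0, 0, 0, 0, 0, 0, 0, 0, 0, 0, 0, 0, 0, 0, 0, 0, 0, 0], by decide +kernel⟩
    weightCount_selfDual_fortyfour (by decide)

end TernaryCode

theorem theorem1 (n d : ℕ)
    (hnd : (n, d) ∈ ({(8, 3), (16, 6), (20, 6), (28, 9), (32, 9), (44, 12)} : Set (ℕ × ℕ))) :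
    (∃ C : TernaryCode n, C.IsDoubleCirculant ∧ C.HasParams (n / 2) d ∧ ¬ C.IsSelfDual ∧
      ∀ C' : TernaryCode n, C'.IsSelfDual → C'.HasParams (n / 2) d → C.PerformsBetter C') ∧
    (∃ C : TernaryCode n, C.IsDoubleTwistulant ∧ C.HasParams (n / 2) d ∧ ¬ C.IsSelfDual ∧
      ∀ C' : TernaryCode n, C'.IsSelfDual → C'.HasParams (n / 2) d → C.PerformsBetter C') := by
  simp only [Set.mem_insert_iff, Set.mem_singleton_iff, Prod.mk.injEq] at hnd
  rcases hnd with ⟨rfl, rfl⟩ | ⟨rfl, rfl⟩ | ⟨rfl, rfl⟩ | ⟨rfl, rfl⟩ | ⟨rfl, rfl⟩ | ⟨rfl, rfl⟩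
  · exact ⟨TernaryCode.exists_doubleCirculant_eight, TernaryCode.exists_doubleTwistulant_eight⟩
  · exact ⟨TernaryCode.exists_doubleCirculant_sixteen, TernaryCode.exists_doubleTwistulant_sixteen⟩
  · exact ⟨TernaryCode.exists_doubleCirculant_twenty, TernaryCode.exists_doubleTwistulant_twenty⟩
  · exact ⟨TernaryCode.exists_doubleCirculant_twentyeight, TernaryCode.exists_doubleTwistulant_twentyeight⟩
  · exact ⟨TernaryCode.exists_doubleCirculant_thirtytwo, TernaryCode.exists_doubleTwistulant_thirtytwo⟩
  · exact ⟨TernaryCode.exists_doubleCirculant_fortyfour, TernaryCode.exists_doubleTwistulant_fortyfour⟩
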